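/- Let $\nu$ be a $\sigma$-finite measure on a measurable space and let $f_0,f_1$ be probability densities with respect to $\nu$ whose Kullback--Leibler divergences $$I_0=\int \log\frac{f_0}{f_1}\,f_0\,d\nu,\qquad I_1=\int \log\frac{f_1}{f_0}\,f_1\,d\nu$$ are both positive and finite. For $i\in\{0,1\}$ let $\mathsf P_i$ (with expectation $\mathsf E_i$) be the law under which the observations $X_1,X_2,\dots$ are i.i.d. with density $f_i$, and set $\mathcal F_n=\sigma(X_1,\dots,X_n)$ and $\bar\Lambda_n=\frac1n\sum_{j=1}^n\log\frac{f_1(X_j)}{f_0(X_j)}$, $n\ge 1$. For $\alpha,\beta\in(0,1)$ let $\mathcal E(\alpha,\beta)$ be the class of pairs $(T,D)$ where $T$ is a stopping time of $(\mathcal F_n)_{n\ge1}$ with $T\ge 1$ that is finite almost surely under $\mathsf P_0$ and $\mathsf P_1$, $D$ is a $\{0,1\}$-valued random variable with $\{T=n,D=i\}\in\mathcal F_n$ for all $n\geq 1$, $i\in\{0,1\}$, and $\mathsf P_0(D=1)\le\alpha$, $\mathsf P_1(D=0)\le\beta$. Let $\mathcal L_i(\alpha,\beta)=\inf_{(T,D)\in\mathcal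 E(\alpha,\beta)}\mathsf E_i[T]$, and let $$n^*(\alpha,\beta)=\min\{n\ge1:\ \exists\,c\in\mathbb R,\ \mathsf P_0(\bar\Lambda_n>c)\le\alpha,\ \mathsf P_1(\bar\Lambda_n\le c)\le\beta\}.$$ Let $$\psi_0(c)=\sup_{\theta\ge0}\Big\{\theta c-\log\int f_1^{\theta}f_0^{1-\theta}\,d\nu\Big\},\qquad \psi_1(c)=\sup_{\theta\le0}\Big\{\theta c-\log\int f_0^{-\theta}f_1^{1+\theta}\,d\nu\Big\},$$ let $g^{-1}:(0,\infty)\to(-I_0,I_1)$ be the inverse of $g=\psi_0/\psi_1$ on $(-I_0,I_1)$, and set $h_i(\alpha,\beta)=\psi_i\big(g^{-1}(|\log\alpha|/|\log\beta|)\big)$ for $i\in\{0,1\}$. Let $(\alpha_k)$ and $(\beta_k)$ be sequences in $(0,1)$ that converge to $0$. (i) If $|\log\alpha_k|/|\log\beta_k|\to0$, then $h_1(\alpha_k,\beta_k)\to I_0$, $\ \mathcal L_1(\alpha_k,\beta_k)/n^*(\alpha_k,\beta_k)\to0$ and $n^*(\alpha_k,\beta_k)/\mathcal L_0(\alpha_k,\beta_k)\to1$.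 (ii) If $|\log\alpha_k|/|\log\beta_k|\to\infty$, then $h_0(\alpha_k,\beta_k)\to I_1$, $\ \mathcal L_0(\alpha_k,\beta_k)/n^*(\alpha_k,\beta_k)\to0$ and $n^*(\alpha_k,\beta_k)/\mathcal L_1(\alpha_k,\beta_k)\to1$. -/

import Mathlib

open MeasureTheory Filter Topology Set
open scoped ENNReal NNReal

noncomputable section

/-- A binary testing problem: a `σ`-finite reference measure `ν` and two probability densities
`f 0`, `f 1` (the null and the alternative hypothesis) with respect to `ν`. -/
structure BinaryTestingProblem (𝓧 : Type*) [MeasurableSpace 𝓧] where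
  ν : Measure 𝓧
  sigmaFinite : SigmaFinite ν
  f : Fin 2 → 𝓧 → ℝ≥0
  measurable_f : ∀ i, Measurable (f i)
  lintegral_f : ∀ i, ∫⁻ x, (f i x : ℝ≥0∞) ∂ν = 1

/-- The `σ`-algebra generated by the first `n` observations `X₁, …, Xₙ` of an infinite sequence;
`X_{j+1}` is the coordinate `ω ↦ ω j`. -/
abbrev obsSigma (𝓧 : Type*) [m : MeasurableSpace 𝓧] (n : ℕ) : MeasurableSpace (ℕ → 𝓧) :=
  ⨆ j : Fin n, MeasurableSpace.comap (fun ω : ℕ → 𝓧 => ω j) m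

/-- A pair `(T, D)` of a stopping time and a binary decision that depends only on the observations
collected up to time `T`. The value `T = ⊤` means that sampling never stops. -/
structure SequentialTest (𝓧 : Type*) [MeasurableSpace 𝓧] where
  T : (ℕ → 𝓧) → ℕ∞
  D : (ℕ → 𝓧) → Fin 2
  one_le_T : ∀ ω, 1 ≤ T ω
  measurableSet_T : ∀ n : ℕ, MeasurableSet[obsSigma 𝓧 n] {ω | T ω = (n : ℕ∞)}
  measurable_D : Measurable D
  measurableSet_D : ∀ (n : ℕ) (i : Fin 2),
    MeasurableSet[obsSigma 𝓧 n] {ω | T ω = (n : ℕ∞) ∧ D ω = i}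

namespace BinaryTestingProblem

variable {𝓧 : Type*} [MeasurableSpace 𝓧] (M : BinaryTestingProblem 𝓧)

/-- The law of one observation under hypothesis `i`. -/
def law (i : Fin 2) : Measure 𝓧 := M.ν.withDensity fun x => (M.f i x : ℝ≥0∞)

instance isProbabilityMeasure_law (i : Fin 2) : IsProbabilityMeasure (M.law i) :=
  ⟨by simp [law, M.lintegral_f i]⟩

/-- `P i`: the law of the i.i.d. sequence of observations under hypothesis `i`. -/
def P (i : Fin 2) : Measure (ℕ → 𝓧) := Measure.infinitePi fun _ : ℕ => M.law i

/-- The Kullback–Leibler divergence `I₀ = ∫ log (f₀ / f₁) f₀ dν`, with values in `[0, ∞]`. -/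
def I₀ : ℝ≥0∞ := InformationTheory.klDiv (M.law 0) (M.law 1)

/-- The Kullback–Leibler divergence `I₁ = ∫ log (f₁ / f₀) f₁ dν`, with values in `[0, ∞]`. -/
def I₁ : ℝ≥0∞ := InformationTheory.klDiv (M.law 1) (M.law 0)

/-- The log-likelihood ratio of the first `n` observations. (When the two divergences are finite,
both densities are positive at all observations almost surely under both hypotheses.) -/
def llrSum (n : ℕ) (ω : ℕ → 𝓧) : ℝ :=
  ∑ j ∈ Finset.range n, Real.log ((M.f 1 (ω j) : ℝ) / (M.f 0 (ω j) : ℝ))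

/-- The average log-likelihood ratio of the first `n` observations. -/
def avgLlr (n : ℕ) (ω : ℕ → 𝓧) : ℝ := M.llrSum n ω / n

/-- The class of tests that terminate almost surely under both hypotheses and whose
type-I and type-II error probabilities are at most `α` and `β`. -/
def testClass (α β : ℝ) : Set (SequentialTest 𝓧) :=
  {τ | (∀ i, ∀ᵐ ω ∂(M.P i), τ.T ω ≠ ⊤) ∧
    M.P 0 {ω | τ.D ω = 1} ≤ ENNReal.ofReal α ∧ M.P 1 {ω | τ.D ω = 0} ≤ ENNReal.ofReal β}

/-- The optimal expected sample size under hypothesis `i`. -/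
def optESS (i : Fin 2) (α β : ℝ) : ℝ≥0∞ :=
  ⨅ τ ∈ M.testClass α β, ∫⁻ ω, (τ.T ω : ℝ≥0∞) ∂(M.P i)

/-- The smallest sample size of a fixed-sample-size test with error probabilities at most
`α` and `β`. -/
def nStar (α β : ℝ) : ℕ :=
  sInf {n : ℕ | 1 ≤ n ∧ ∃ c : ℝ, M.P 0 {ω | c < M.avgLlr n ω} ≤ ENNReal.ofReal α ∧
    M.P 1 {ω | M.avgLlr n ω ≤ c} ≤ ENNReal.ofReal β}

/-- `ψ₀ c = sup_{θ ≥ 0} (θ c - log ∫ f₁^θ f₀^(1-θ) dν)`. -/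
def ψ₀ (c : ℝ) : EReal :=
  ⨆ (θ : ℝ) (_ : 0 ≤ θ), ((θ * c : ℝ) : EReal) -
    ENNReal.log (∫⁻ x, (M.f 1 x : ℝ≥0∞) ^ θ * (M.f 0 x : ℝ≥0∞) ^ (1 - θ) ∂M.ν)

/-- `ψ₁ c = sup_{θ ≤ 0} (θ c - log ∫ f₀^(-θ) f₁^(1+θ) dν)`, the Legendre transform of the
log-moment generating function of `log (f₁ / f₀)` under hypothesis `1`. -/
def ψ₁ (c : ℝ) : EReal :=
  ⨆ (θ : ℝ) (_ : θ ≤ 0), ((θ * c : ℝ) : EReal) -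
    ENNReal.log (∫⁻ x, (M.f 0 x : ℝ≥0∞) ^ (-θ) * (M.f 1 x : ℝ≥0∞) ^ (1 + θ) ∂M.ν)

/-- The ratio `ψ₀ / ψ₁`, used on the interval `(-I₀, I₁)`, where both are finite and positive. -/
def g (c : ℝ) : ℝ := (M.ψ₀ c).toReal / (M.ψ₁ c).toReal

/-- The inverse of `g : (-I₀, I₁) → (0, ∞)`. -/
def gInv (u : ℝ) : ℝ := Function.invFunOn M.g (Ioo (-M.I₀.toReal) M.I₁.toReal) u

/-- `h₀(α, β) = ψ₀ (g⁻¹ (|log α| / |log β|))`. -/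
def h₀ (α β : ℝ) : ℝ := (M.ψ₀ (M.gInv (|Real.log α| / |Real.log β|))).toReal

/-- `h₁(α, β) = ψ₁ (g⁻¹ (|log α| / |log β|))`. -/
def h₁ (α β : ℝ) : ℝ := (M.ψ₁ (M.gInv (|Real.log α| / |Real.log β|))).toReal

end BinaryTestingProblem

end

/-!
Write `Λₙ` for the sum of the log-likelihood ratios of the first `n` observations, suppose that
`|log α| = o(|log β|)`, and put `t = |log β|`; part (ii) is the same with the hypotheses exchanged.

* Lower bound. A change of measure from hypothesis `1` to hypothesis `0` shows that a test which
  correctly decides for `0` typically needs `-Λ_T ≥ t`, and by the law of large numbers this takes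
  about `t / I₀` observations under `0`. Hence `𝓛₀` and `n*` are at least `(1 - o(1)) t / I₀`.
* Upper bound. The likelihood ratio test with `y t` observations, `y > 1 / I₀`, and threshold
  `-1 / y` per observation has type II error at most `exp (-t)` by Markov's inequality and type I
  error at most `exp (-r t)` for some `r > 0` by Chernoff's inequality. Since `|log α| ≤ r t`
  eventually, `n*`, and with it `𝓛₀`, is at most `(1 + o(1)) t / I₀`.
* Wald's sequential test takes `O(|log α| + 1) = o(t)` observations on average under hypothesis `1`,
  so `𝓛₁` is negligible against `n*`.
* On `(-I₀, I₁)` both suprema are attained for `|θ| ≤ 1`, and `ψ₁ c = ψ₀ c - c`. As `ψ₁` is bounded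
  there, `g → 0` forces `ψ₀ → 0`, hence `c → -I₀` and `ψ₁ → I₀`.
-/

open ProbabilityTheory InformationTheory

lemma lintegral_pi_prod {κ : Type*} [Fintype κ] {Y : κ → Type*} [∀ k, MeasurableSpace (Y k)]
    (μ : ∀ k, Measure (Y k)) [∀ k, IsProbabilityMeasure (μ k)] {φ : ∀ k, Y k → ℝ≥0∞}
    (hφ : ∀ k, Measurable (φ k)) :
    ∫⁻ x, ∏ k, φ k (x k) ∂Measure.pi μ = ∏ k, ∫⁻ y, φ k y ∂μ k := by
  rw [lintegral_prod_eq_prod_lintegral_of_indepFun _ _ (iIndepFun_pi fun k => (hφ k).aemeasurable)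
    fun k => (hφ k).comp (measurable_pi_apply k)]
  exact Finset.prod_congr rfl fun k _ => (measurePreserving_eval μ k).lintegral_comp (hφ k)

/-- `L` is a version of the logarithm of the density `dν/dμ`. Since `L` is real valued, the two
measures are then equivalent. -/
structure IsLogLikelihoodRatio {𝓨 : Type*} [MeasurableSpace 𝓨] (μ ν : Measure 𝓨) (L : 𝓨 → ℝ) :
    Prop where
  measurable : Measurable L
  withDensity_exp : μ.withDensity (fun x => ENNReal.ofReal (Real.exp (L x))) = ν

namespace IsLogLikelihoodRatio

variable {𝓨 : Type*} [MeasurableSpace 𝓨] {μ ν : Measure 𝓨} {L : 𝓨 → ℝ}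

lemma lintegral_eq (h : IsLogLikelihoodRatio μ ν L) {φ : 𝓨 → ℝ≥0∞} (hφ : Measurable φ) :
    ∫⁻ x, φ x ∂ν = ∫⁻ x, ENNReal.ofReal (Real.exp (L x)) * φ x ∂μ := by
  rw [← h.withDensity_exp,
    lintegral_withDensity_eq_lintegral_mul _ h.measurable.exp.ennreal_ofReal hφ]
  rfl

lemma symm (h : IsLogLikelihoodRatio μ ν L) : IsLogLikelihoodRatio ν μ (-L) where
  measurable := h.measurable.neg
  withDensity_exp := by
    rw [← h.withDensity_exp, ← withDensity_mul _ h.measurable.exp.ennreal_ofReal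
      h.measurable.neg.exp.ennreal_ofReal]
    convert withDensity_one (μ := μ) using 2
    ext x
    simp [← ENNReal.ofReal_mul (Real.exp_nonneg _), ← Real.exp_add]

lemma absolutelyContinuous (h : IsLogLikelihoodRatio μ ν L) : ν ≪ μ :=
  h.withDensity_exp ▸ withDensity_absolutelyContinuous _ _

lemma measure_le_exp_mul (h : IsLogLikelihoodRatio μ ν L) {A : Set 𝓨} (hA : MeasurableSet A)
    {b : ℝ} (hb : ∀ x ∈ A, L x ≤ b) : ν A ≤ ENNReal.ofReal (Real.exp b) * μ A := by
  rw [← h.withDensity_exp, withDensity_apply _ hA, ← setLIntegral_const]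
  exact setLIntegral_mono measurable_const fun x hx => by gcongr; exact hb x hx

lemma llr_ae_eq [SigmaFinite μ] (h : IsLogLikelihoodRatio μ ν L) : llr ν μ =ᵐ[μ] L := by
  have hrn := Measure.rnDeriv_withDensity μ h.measurable.exp.ennreal_ofReal
  rw [h.withDensity_exp] at hrn
  filter_upwards [hrn] with x hx
  rw [llr, hx, ENNReal.toReal_ofReal (Real.exp_nonneg _), Real.log_exp]

lemma integrable [SigmaFinite ν] (h : IsLogLikelihoodRatio μ ν L)
    (hkl : klDiv μ ν ≠ ∞) : Integrable L μ := by
  have hllr := (klDiv_ne_top_iff.1 hkl).2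
  rw [integrable_congr (h.symm.absolutelyContinuous.ae_le h.symm.llr_ae_eq)] at hllr
  simpa using hllr.neg

lemma integral_eq_neg_toReal_klDiv [IsProbabilityMeasure μ] [IsProbabilityMeasure ν]
    (h : IsLogLikelihoodRatio μ ν L) :
    μ[L] = -(klDiv μ ν).toReal := by
  rw [toReal_klDiv_of_measure_eq h.symm.absolutelyContinuous (by simp),
    integral_congr_ae (h.symm.absolutelyContinuous.ae_le h.symm.llr_ae_eq), ← integral_neg]
  simp

lemma lintegral_exp_mul (h : IsLogLikelihoodRatio μ ν L) (s : ℝ) :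
    ∫⁻ x, ENNReal.ofReal (Real.exp (s * L x)) ∂ν =
      ∫⁻ x, ENNReal.ofReal (Real.exp ((s + 1) * L x)) ∂μ := by
  have hL := h.measurable
  rw [h.lintegral_eq (by fun_prop)]
  refine lintegral_congr fun x => ?_
  rw [← ENNReal.ofReal_mul (Real.exp_nonneg _), ← Real.exp_add]
  ring_nf

lemma mgf_eq (h : IsLogLikelihoodRatio μ ν L) (s : ℝ) : mgf L ν s = mgf L μ (s + 1) := by
  have hL := h.measurable
  simp only [mgf]
  rw [integral_eq_lintegral_of_nonneg_ae (ae_of_all _ fun _ => Real.exp_nonneg _) (by fun_prop),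
    integral_eq_lintegral_of_nonneg_ae (ae_of_all _ fun _ => Real.exp_nonneg _) (by fun_prop),
    h.lintegral_exp_mul]

lemma cgf_neg (h : IsLogLikelihoodRatio μ ν L) (s : ℝ) : cgf (-L) ν s = cgf L μ (1 - s) := by
  simp only [cgf, mgf_neg, h.mgf_eq, sub_eq_neg_add]

lemma cgf_one [IsProbabilityMeasure ν] (h : IsLogLikelihoodRatio μ ν L) : cgf L μ 1 = 0 := by
  simpa using (h.cgf_neg 0).symm

lemma integrable_exp [IsFiniteMeasure ν] (h : IsLogLikelihoodRatio μ ν L) :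
    Integrable (fun x => Real.exp (L x)) μ := by
  rw [← lintegral_ofReal_ne_top_iff_integrable h.measurable.exp.aestronglyMeasurable
    (ae_of_all _ fun _ => Real.exp_nonneg _), ← setLIntegral_univ,
    ← withDensity_apply _ MeasurableSet.univ, h.withDensity_exp]
  exact measure_ne_top _ _

lemma integrable_exp_mul [IsFiniteMeasure μ] [IsFiniteMeasure ν] (h : IsLogLikelihoodRatio μ ν L)
    {s : ℝ} (hs : s ∈ Icc (0 : ℝ) 1) : Integrable (fun x => Real.exp (s * L x)) μ :=
  integrable_exp_mul_of_nonneg_of_le (u := 1) (by simpa using h.integrable_exp) hs.1 hs.2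

protected lemma pi {κ : Type*} [Fintype κ] {Y : κ → Type*} [∀ k, MeasurableSpace (Y k)]
    {μ ν : ∀ k, Measure (Y k)} {L : ∀ k, Y k → ℝ} [∀ k, IsProbabilityMeasure (μ k)]
    [∀ k, SigmaFinite (ν k)] (h : ∀ k, IsLogLikelihoodRatio (μ k) (ν k) (L k)) :
    IsLogLikelihoodRatio (Measure.pi μ) (Measure.pi ν) (fun x => ∑ k, L k (x k)) where
  measurable := Finset.measurable_sum _ fun k _ => (h k).measurable.comp (measurable_pi_apply k)
  withDensity_exp := by
    refine (Measure.pi_eq fun s hs => ?_).symm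
    have hprod (x : ∀ k, Y k) : (univ.pi s).indicator
        (fun x => ENNReal.ofReal (Real.exp (∑ k, L k (x k)))) x =
        ∏ k, (s k).indicator (fun y => ENNReal.ofReal (Real.exp (L k y))) (x k) := by
      by_cases hx : x ∈ univ.pi s
      · rw [indicator_of_mem hx, Real.exp_sum,
          ENNReal.ofReal_prod_of_nonneg fun _ _ => Real.exp_nonneg _]
        exact Finset.prod_congr rfl fun k _ => by rw [indicator_of_mem (hx k (mem_univ k))]
      · obtain ⟨k, hk⟩ : ∃ k, x k ∉ s k := by simpa using hx
        rw [indicator_of_notMem hx, Finset.prod_eq_zero (Finset.mem_univ k)]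
        exact indicator_of_notMem hk _
    rw [withDensity_apply _ (.univ_pi hs), ← lintegral_indicator (.univ_pi hs)]
    simp only [hprod]
    rw [lintegral_pi_prod μ fun k => (h k).measurable.exp.ennreal_ofReal.indicator (hs k)]
    refine Finset.prod_congr rfl fun k _ => ?_
    rw [lintegral_indicator (hs k), ← withDensity_apply _ (hs k), (h k).withDensity_exp]

end IsLogLikelihoodRatio

section Mgf

variable {Ω : Type*} [MeasurableSpace Ω] {μ : Measure Ω} [IsProbabilityMeasure μ] {X : Ω → ℝ}

lemma ofReal_exp_mul_integral_le_lintegral (hX : Integrable X μ) (s : ℝ) :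
    ENNReal.ofReal (Real.exp (s * μ[X])) ≤ ∫⁻ ω, ENNReal.ofReal (Real.exp (s * X ω)) ∂μ := by
  have hsX : Integrable (fun ω => s * X ω) μ := hX.const_mul s
  by_cases hexp : Integrable (fun ω => Real.exp (s * X ω)) μ
  · rw [← ofReal_integral_eq_lintegral_ofReal hexp (ae_of_all _ fun _ => Real.exp_nonneg _),
      ← integral_const_mul]
    exact ENNReal.ofReal_le_ofReal (convexOn_exp.map_integral_le Real.continuous_exp.continuousOn
      isClosed_univ (ae_of_all _ fun _ => mem_univ _) hsX hexp)
  · rw [← lintegral_ofReal_ne_top_iff_integrable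
      (Real.continuous_exp.comp_aestronglyMeasurable hsX.1)
      (ae_of_all _ fun _ => Real.exp_nonneg _), not_not] at hexp
    exact hexp ▸ le_top

lemma abs_exp_mul_sub_one_div_le {s : ℝ} (hs : s ∈ Ioo (0 : ℝ) 1) (y : ℝ) :
    |(Real.exp (s * y) - 1) / s| ≤ |y| + (Real.exp y + 1) := by
  have hconvex : Real.exp (s * y) ≤ (1 - s) + s * Real.exp y := by
    simpa using convexOn_exp.2 (mem_univ 0) (mem_univ y) (sub_nonneg.2 hs.2.le) hs.1.le
      (sub_add_cancel 1 s)
  have htangent := Real.add_one_le_exp (s * y)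
  have hpos := Real.exp_pos y
  rw [abs_le, le_div_iff₀ hs.1, div_le_iff₀ hs.1]
  constructor
  · nlinarith [neg_abs_le y, hs.1]
  · nlinarith [abs_nonneg y, hs.1]

lemma tendsto_mgf_sub_one_div (hX : Integrable X μ)
    (hexp : Integrable (fun ω => Real.exp (X ω)) μ) :
    Tendsto (fun s => (mgf X μ s - 1) / s) (𝓝[>] 0) (𝓝 μ[X]) := by
  have hlim : Tendsto (fun s : ℝ => ∫ ω, (Real.exp (s * X ω) - 1) / s ∂μ) (𝓝[>] 0) (𝓝 μ[X]) := by
    refine tendsto_integral_filter_of_dominated_convergence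
      (fun ω => |X ω| + (Real.exp (X ω) + 1)) ?_ ?_ (by fun_prop) (ae_of_all _ fun ω => ?_)
    · exact Eventually.of_forall fun s => by fun_prop
    · filter_upwards [Ioo_mem_nhdsGT (zero_lt_one (α := ℝ))] with s hs
      exact ae_of_all _ fun ω => abs_exp_mul_sub_one_div_le hs (X ω)
    · have hderiv : HasDerivAt (fun s : ℝ => Real.exp (s * X ω)) (X ω) 0 := by
        simpa using ((hasDerivAt_id (0 : ℝ)).mul_const (X ω)).exp
      simpa [div_eq_inv_mul] using hderiv.tendsto_slope_zero_right
  refine hlim.congr' ?_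
  filter_upwards [Ioo_mem_nhdsGT (zero_lt_one (α := ℝ))] with s hs
  rw [integral_div, integral_sub (integrable_exp_mul_of_nonneg_of_le (u := 1) (by simpa using hexp)
    hs.1.le hs.2.le) (integrable_const _)]
  simp [mgf]

lemma exists_mgf_lt_exp_mul (hX : Integrable X μ) (hexp : Integrable (fun ω => Real.exp (X ω)) μ)
    {c : ℝ} (hc : μ[X] < c) : ∃ s ∈ Ioo (0 : ℝ) 1, mgf X μ s < Real.exp (s * c) := by
  obtain ⟨s, hlt, hs⟩ := (((tendsto_mgf_sub_one_div hX hexp).eventually (gt_mem_nhds hc)).and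
    (Ioo_mem_nhdsGT (zero_lt_one (α := ℝ)))).exists
  rw [div_lt_iff₀ hs.1] at hlt
  exact ⟨s, hs, by linarith [Real.add_one_le_exp (s * c)]⟩

end Mgf

/-- The Chernoff rate at level `c` of a log-likelihood ratio `L` with respect to `μ`: the Legendre
transform of its cumulant generating function, with the supremum restricted to `[0, 1]`, where
the cumulant generating function is always finite. -/
noncomputable def chernoffRate {𝓨 : Type*} [MeasurableSpace 𝓨] (L : 𝓨 → ℝ) (μ : Measure 𝓨)
    (c : ℝ) : ℝ :=
  ⨆ s : Icc (0 : ℝ) 1, (s * c - cgf L μ s)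

namespace IsLogLikelihoodRatio

variable {𝓨 : Type*} [MeasurableSpace 𝓨] {μ ν : Measure 𝓨} {L : 𝓨 → ℝ}
  [IsProbabilityMeasure μ] [IsProbabilityMeasure ν]

lemma log_lintegral_exp_mul (h : IsLogLikelihoodRatio μ ν L) {s : ℝ} (hs : s ∈ Icc (0 : ℝ) 1) :
    ENNReal.log (∫⁻ x, ENNReal.ofReal (Real.exp (s * L x)) ∂μ) = cgf L μ s := by
  rw [← ofReal_integral_eq_lintegral_ofReal (h.integrable_exp_mul hs)
    (ae_of_all _ fun _ => Real.exp_nonneg _)]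
  exact ENNReal.log_ofReal_of_pos (mgf_pos (h.integrable_exp_mul hs))

lemma mul_integral_le_cgf (h : IsLogLikelihoodRatio μ ν L) (hμ : Integrable L μ) {s : ℝ}
    (hs : s ∈ Icc (0 : ℝ) 1) : s * μ[L] ≤ cgf L μ s := by
  rw [← EReal.coe_le_coe_iff, ← h.log_lintegral_exp_mul hs, ← Real.log_exp (s * μ[L]),
    ← ENNReal.log_ofReal_of_pos (Real.exp_pos _)]
  exact ENNReal.log_monotone (ofReal_exp_mul_integral_le_lintegral hμ s)

lemma bddAbove_range_mul_sub_cgf (h : IsLogLikelihoodRatio μ ν L) (hμ : Integrable L μ) (c : ℝ) :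
    BddAbove (range fun s : Icc (0 : ℝ) 1 => (s * c - cgf L μ s : ℝ)) := by
  refine ⟨|c - μ[L]|, ?_⟩
  rintro _ ⟨s, rfl⟩
  calc (s * c - cgf L μ s : ℝ) ≤ s * (c - μ[L]) := by linarith [h.mul_integral_le_cgf hμ s.2]
    _ ≤ s * |c - μ[L]| := mul_le_mul_of_nonneg_left (le_abs_self _) s.2.1
    _ ≤ |c - μ[L]| := mul_le_of_le_one_left (abs_nonneg _) s.2.2

lemma le_chernoffRate (h : IsLogLikelihoodRatio μ ν L) (hμ : Integrable L μ) (c : ℝ) {s : ℝ}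
    (hs : s ∈ Icc (0 : ℝ) 1) : s * c - cgf L μ s ≤ chernoffRate L μ c :=
  le_ciSup (h.bddAbove_range_mul_sub_cgf hμ c) ⟨s, hs⟩

lemma self_le_chernoffRate (h : IsLogLikelihoodRatio μ ν L) (hμ : Integrable L μ) (c : ℝ) :
    c ≤ chernoffRate L μ c := by
  simpa [h.cgf_one] using h.le_chernoffRate hμ c (right_mem_Icc.2 zero_le_one)

lemma chernoffRate_neg (h : IsLogLikelihoodRatio μ ν L) (hμ : Integrable L μ) (c : ℝ) :
    chernoffRate (-L) ν (-c) = chernoffRate L μ c - c := by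
  rw [chernoffRate, chernoffRate, ciSup_sub (h.bddAbove_range_mul_sub_cgf hμ c)]
  refine unitInterval.symm_bijective.surjective.iSup_congr _ fun s => ?_
  rw [unitInterval.coe_symm_eq, h.cgf_neg]
  ring_nf

lemma monotone_chernoffRate (h : IsLogLikelihoodRatio μ ν L) (hμ : Integrable L μ) :
    Monotone (chernoffRate L μ) := fun c d hcd =>
  ciSup_mono (h.bddAbove_range_mul_sub_cgf hμ d) fun s => by
    gcongr
    exact s.2.1

lemma chernoffRate_integral (h : IsLogLikelihoodRatio μ ν L) (hμ : Integrable L μ) :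
    chernoffRate L μ μ[L] = 0 := by
  refine le_antisymm (ciSup_le fun s => sub_nonpos.2 (h.mul_integral_le_cgf hμ s.2)) ?_
  simpa using h.le_chernoffRate hμ μ[L] (left_mem_Icc.2 zero_le_one)

lemma chernoffRate_pos (h : IsLogLikelihoodRatio μ ν L) (hμ : Integrable L μ) {c : ℝ}
    (hc : μ[L] < c) : 0 < chernoffRate L μ c := by
  obtain ⟨s, hs, hlt⟩ := exists_mgf_lt_exp_mul hμ h.integrable_exp hc
  refine lt_of_lt_of_le ?_ (h.le_chernoffRate hμ c (Ioo_subset_Icc_self hs))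
  rw [sub_pos, cgf, ← Real.log_exp (s * c)]
  exact Real.log_lt_log (mgf_pos (h.integrable_exp_mul (Ioo_subset_Icc_self hs))) hlt

lemma chernoffRate_integral_right (h : IsLogLikelihoodRatio μ ν L) (hμ : Integrable L μ)
    (hν : Integrable L ν) : chernoffRate L μ ν[L] = ν[L] := by
  have hdual := h.symm.chernoffRate_integral hν.neg
  rw [integral_neg', h.chernoffRate_neg hμ] at hdual
  linarith

lemma self_lt_chernoffRate (h : IsLogLikelihoodRatio μ ν L) (hμ : Integrable L μ)
    (hν : Integrable L ν) {c : ℝ} (hc : c < ν[L]) : c < chernoffRate L μ c := by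
  have hdual := h.symm.chernoffRate_pos hν.neg (c := -c) (by simpa [integral_neg] using hc)
  rw [h.chernoffRate_neg hμ] at hdual
  linarith

lemma continuous_chernoffRate (h : IsLogLikelihoodRatio μ ν L) (hμ : Integrable L μ)
    (hν : Integrable L ν) : Continuous (chernoffRate L μ) := by
  refine (LipschitzWith.of_le_add fun c d => ?_).continuous
  rw [Real.dist_eq]
  rcases le_total c d with hcd | hdc
  · linarith [h.monotone_chernoffRate hμ hcd, abs_nonneg (c - d)]
  · have hdual := h.symm.monotone_chernoffRate hν.neg (neg_le_neg hdc)
    rw [h.chernoffRate_neg hμ, h.chernoffRate_neg hμ] at hdual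
    linarith [le_abs_self (c - d)]

lemma exists_chernoffRate_ratio_eq (h : IsLogLikelihoodRatio μ ν L) (hμ : Integrable L μ)
    (hν : Integrable L ν) (hneg : μ[L] < 0) (hpos : 0 < ν[L]) {u : ℝ} (hu : 0 < u) :
    ∃ c ∈ Ioo μ[L] ν[L], chernoffRate L μ c / (chernoffRate L μ c - c) = u := by
  have hcont : ContinuousOn (fun c => chernoffRate L μ c - u * (chernoffRate L μ c - c))
      (Icc μ[L] ν[L]) := by
    have := h.continuous_chernoffRate hμ hν
    fun_prop
  obtain ⟨c, hc, hzero⟩ := intermediate_value_Ioo (hneg.trans hpos).le hcont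
    (show (0 : ℝ) ∈ _ by
      simp only [h.chernoffRate_integral hμ, h.chernoffRate_integral_right hμ hν, mem_Ioo]
      constructor <;> nlinarith)
  refine ⟨c, hc, ?_⟩
  rw [div_eq_iff (sub_pos.2 (h.self_lt_chernoffRate hμ hν hc.2)).ne']
  linarith

lemma tendsto_chernoffRate_sub {ι : Type*} {l : Filter ι} {c : ι → ℝ}
    (h : IsLogLikelihoodRatio μ ν L) (hμ : Integrable L μ) (hν : Integrable L ν)
    (hc : ∀ k, c k ∈ Ioo μ[L] ν[L])
    (hlim : Tendsto (fun k => chernoffRate L μ (c k) / (chernoffRate L μ (c k) - c k)) l (𝓝 0)) :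
    Tendsto (fun k => chernoffRate L μ (c k) - c k) l (𝓝 (-μ[L])) := by
  have hsub_pos (k) : 0 < chernoffRate L μ (c k) - c k :=
    sub_pos.2 (h.self_lt_chernoffRate hμ hν (hc k).2)
  have hsub_le (k) : chernoffRate L μ (c k) - c k ≤ -μ[L] := by
    have hdual := h.symm.monotone_chernoffRate hν.neg (neg_le_neg (hc k).1.le)
    rwa [h.chernoffRate_neg hμ, h.chernoffRate_neg hμ, h.chernoffRate_integral hμ,
      zero_sub] at hdual
  have hrate_pos (k) : 0 < chernoffRate L μ (c k) := h.chernoffRate_pos hμ (hc k).1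
  have hrate : Tendsto (fun k => chernoffRate L μ (c k)) l (𝓝 0) := by
    have hbound := hlim.mul_const (-μ[L])
    rw [zero_mul] at hbound
    refine squeeze_zero (fun k => (hrate_pos k).le) (fun k => ?_) hbound
    rw [← div_le_iff₀ ((hsub_pos k).trans_le (hsub_le k))]
    exact div_le_div_of_nonneg_left (hrate_pos k).le (hsub_pos k) (hsub_le k)
  have hc_lim : Tendsto c l (𝓝 μ[L]) := by
    refine tendsto_order.2 ⟨fun x hx => Eventually.of_forall fun k => hx.trans (hc k).1,
      fun x hx => ?_⟩
    filter_upwards [hrate.eventually (gt_mem_nhds (h.chernoffRate_pos hμ hx))] with k hk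
    exact (h.monotone_chernoffRate hμ).reflect_lt hk
  simpa using hrate.sub hc_lim

lemma tendsto_chernoffRate {ι : Type*} {l : Filter ι} {c : ι → ℝ}
    (h : IsLogLikelihoodRatio μ ν L) (hμ : Integrable L μ) (hν : Integrable L ν)
    (hc : ∀ k, c k ∈ Ioo μ[L] ν[L])
    (hlim : Tendsto (fun k => chernoffRate L μ (c k) / (chernoffRate L μ (c k) - c k)) l atTop) :
    Tendsto (fun k => chernoffRate L μ (c k)) l (𝓝 ν[L]) := by
  have hdual := h.symm.tendsto_chernoffRate_sub hν.neg hμ.neg (c := fun k => -c k) (l := l)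
    (fun k => by simpa [integral_neg, and_comm] using hc k)
    (hlim.inv_tendsto_atTop.congr fun k => by simp [h.chernoffRate_neg hμ])
  simpa [h.chernoffRate_neg hμ, integral_neg] using hdual

end IsLogLikelihoodRatio

/-- The Legendre transform, restricted to nonnegative arguments, of the logarithm of the moment
generating function of `L` under `μ`. -/
noncomputable def legendreNonneg {𝓨 : Type*} [MeasurableSpace 𝓨] (L : 𝓨 → ℝ) (μ : Measure 𝓨)
    (c : ℝ) : EReal :=
  ⨆ (θ : ℝ) (_ : 0 ≤ θ), ((θ * c : ℝ) : EReal) -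
    ENNReal.log (∫⁻ x, ENNReal.ofReal (Real.exp (θ * L x)) ∂μ)

lemma IsLogLikelihoodRatio.legendreNonneg_eq_chernoffRate {𝓨 : Type*} [MeasurableSpace 𝓨]
    {μ ν : Measure 𝓨} {L : 𝓨 → ℝ} [IsProbabilityMeasure μ] [IsProbabilityMeasure ν]
    (h : IsLogLikelihoodRatio μ ν L) (hμ : Integrable L μ) (hν : Integrable L ν) {c : ℝ}
    (hc : c ≤ ν[L]) : legendreNonneg L μ c = chernoffRate L μ c := by
  refine le_antisymm (iSup₂_le fun θ hθ => ?_) ?_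
  · rcases le_total θ 1 with hθ1 | hθ1
    · rw [h.log_lintegral_exp_mul ⟨hθ, hθ1⟩]
      exact_mod_cast h.le_chernoffRate hμ c ⟨hθ, hθ1⟩
    · have hshift := h.lintegral_exp_mul (θ - 1)
      rw [sub_add_cancel] at hshift
      have hjensen := ENNReal.log_monotone (ofReal_exp_mul_integral_le_lintegral hν (θ - 1))
      rw [hshift, ENNReal.log_ofReal_of_pos (Real.exp_pos _), Real.log_exp] at hjensen
      refine (EReal.sub_le_sub le_rfl hjensen).trans ?_
      have hself := h.self_le_chernoffRate hμ c
      exact_mod_cast (by nlinarith : θ * c - (θ - 1) * ν[L] ≤ chernoffRate L μ c)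
  · refine EReal.ge_of_forall_gt_iff_ge.1 fun x hx => ?_
    obtain ⟨s, hs⟩ := exists_lt_of_lt_ciSup (EReal.coe_lt_coe_iff.1 hx)
    refine le_iSup₂_of_le s.1 s.2.1 ?_
    rw [h.log_lintegral_exp_mul s.2]
    exact_mod_cast hs.le

section IidObservations

/-- The sum of the statistic `L` over the first `n` observations. -/
def obsSum {𝓧 : Type*} (L : 𝓧 → ℝ) (n : ℕ) (ω : ℕ → 𝓧) : ℝ :=
  ∑ k ∈ Finset.range n, L (ω k)

@[simp]
lemma obsSum_zero {𝓧 : Type*} (L : 𝓧 → ℝ) : obsSum L 0 = 0 := by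
  ext
  simp [obsSum]

@[simp]
lemma obsSum_neg {𝓧 : Type*} (L : 𝓧 → ℝ) (n : ℕ) : obsSum (-L) n = -obsSum L n := by
  ext ω
  simp [obsSum]

variable {𝓧 : Type*} [MeasurableSpace 𝓧] {μ ν : Measure 𝓧} {L : 𝓧 → ℝ}

/-- The law of an infinite sequence of independent observations with common distribution `μ`. -/
noncomputable abbrev iidLaw (μ : Measure 𝓧) : Measure (ℕ → 𝓧) :=
  Measure.infinitePi fun _ : ℕ => μ

lemma obsSigma_mono : Monotone (obsSigma 𝓧) := fun _ _ h =>
  iSup_le fun j => le_iSup (fun j : Fin _ => MeasurableSpace.comap (fun ω : ℕ → 𝓧 => ω j) _)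
    (Fin.castLE h j)

lemma obsSigma_le (n : ℕ) : obsSigma 𝓧 n ≤ MeasurableSpace.pi :=
  iSup_le fun j => (measurable_pi_apply (j : ℕ)).comap_le

lemma obsSigma_eq_comap (n : ℕ) :
    obsSigma 𝓧 n = MeasurableSpace.comap (fun ω (k : Fin n) => ω k) MeasurableSpace.pi := by
  simp only [obsSigma, MeasurableSpace.pi, MeasurableSpace.comap_iSup, MeasurableSpace.comap_comp]
  rfl

lemma measurable_obsSum_obsSigma (hL : Measurable L) (n : ℕ) :
    Measurable[obsSigma 𝓧 n] (obsSum L n) := by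
  refine Finset.measurable_sum _ fun k hk => hL.comp (measurable_iff_comap_le.2 ?_)
  exact le_iSup (fun j : Fin n => MeasurableSpace.comap (fun ω : ℕ → 𝓧 => ω j) _)
    ⟨k, Finset.mem_range.1 hk⟩

@[fun_prop]
lemma measurable_obsSum (hL : Measurable L) (n : ℕ) : Measurable (obsSum L n) :=
  (measurable_obsSum_obsSigma hL n).mono (obsSigma_le n) le_rfl

lemma map_iidLaw_fin [IsProbabilityMeasure μ] (n : ℕ) :
    (iidLaw μ).map (fun ω (k : Fin n) => ω k) = Measure.pi fun _ => μ := by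
  have hindep : iIndepFun (fun (k : Fin n) (ω : ℕ → 𝓧) => ω k) (iidLaw μ) :=
    (iIndepFun_infinitePi (X := fun _ => id) fun _ => measurable_id).precomp Fin.val_injective
  rw [(iIndepFun_iff_map_fun_eq_pi_map fun k : Fin n =>
    (measurable_pi_apply (k : ℕ)).aemeasurable).1 hindep]
  simp only [iidLaw, Measure.infinitePi_map_eval]

namespace IsLogLikelihoodRatio

variable [IsProbabilityMeasure μ] [IsProbabilityMeasure ν]

lemma iidLaw_le_exp_mul (h : IsLogLikelihoodRatio μ ν L) {n : ℕ} {A : Set (ℕ → 𝓧)}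
    (hA : MeasurableSet[obsSigma 𝓧 n] A) {b : ℝ} (hb : ∀ ω ∈ A, obsSum L n ω ≤ b) :
    iidLaw ν A ≤ ENNReal.ofReal (Real.exp b) * iidLaw μ A := by
  rw [obsSigma_eq_comap] at hA
  obtain ⟨B, hB, rfl⟩ := hA
  have hproj : Measurable fun (ω : ℕ → 𝓧) (k : Fin n) => ω k := by fun_prop
  set B' := B ∩ {x | ∑ k, L (x k) ≤ b}
  have hL := h.measurable
  have hB' : MeasurableSet B' := hB.inter (measurableSet_le (by fun_prop) measurable_const)
  have hpre : (fun (ω : ℕ → 𝓧) (k : Fin n) => ω k) ⁻¹' B = (fun ω (k : Fin n) => ω k) ⁻¹' B' := by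
    refine (inter_eq_left.2 fun ω hω => ?_).symm
    have hsum := hb ω hω
    rwa [obsSum, Finset.sum_range] at hsum
  rw [hpre, ← Measure.map_apply hproj hB', ← Measure.map_apply hproj hB', map_iidLaw_fin,
    map_iidLaw_fin]
  exact (IsLogLikelihoodRatio.pi fun _ : Fin n => h).measure_le_exp_mul hB' fun x hx => hx.2

/-- Wald's form of the change of measure: the sample size at which the likelihood ratio is
evaluated may vary over the event. -/
lemma iidLaw_iUnion_le_exp_mul (h : IsLogLikelihoodRatio μ ν L) {A : ℕ → Set (ℕ → 𝓧)}
    (hA : ∀ n, MeasurableSet[obsSigma 𝓧 n] (A n)) (hd : Pairwise (Function.onFun Disjoint A))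
    {b : ℝ} (hb : ∀ n, ∀ ω ∈ A n, obsSum L n ω ≤ b) :
    iidLaw ν (⋃ n, A n) ≤ ENNReal.ofReal (Real.exp b) * iidLaw μ (⋃ n, A n) :=
  calc iidLaw ν (⋃ n, A n) ≤ ∑' n, iidLaw ν (A n) := measure_iUnion_le _
    _ ≤ ∑' n, ENNReal.ofReal (Real.exp b) * iidLaw μ (A n) :=
        ENNReal.tsum_le_tsum fun n => h.iidLaw_le_exp_mul (hA n) (hb n)
    _ = ENNReal.ofReal (Real.exp b) * iidLaw μ (⋃ n, A n) := by
        rw [ENNReal.tsum_mul_left, measure_iUnion hd fun n => obsSigma_le n _ (hA n)]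

lemma iidLaw_obsSum_le (h : IsLogLikelihoodRatio μ ν L) (n : ℕ) (b : ℝ) :
    iidLaw ν {ω | obsSum L n ω ≤ b} ≤ ENNReal.ofReal (Real.exp b) :=
  (h.iidLaw_le_exp_mul (measurable_obsSum_obsSigma h.measurable n measurableSet_Iic)
    fun _ hω => hω).trans (mul_le_of_le_one_right' prob_le_one)

end IsLogLikelihoodRatio

variable [IsProbabilityMeasure μ]

lemma identDistrib_eval_iidLaw (hL : Measurable L) (k : ℕ) :
    IdentDistrib (fun ω : ℕ → 𝓧 => L (ω k)) L (iidLaw μ) μ :=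
  .comp ⟨(measurable_pi_apply k).aemeasurable, aemeasurable_id, by
    rw [Measure.infinitePi_map_eval]; exact Measure.map_id.symm⟩ hL

lemma iidLaw_le_obsSum_le_exp_mul_mgf_pow (hL : Measurable L) {s : ℝ} (hs : 0 ≤ s)
    (hint : Integrable (fun x => Real.exp (s * L x)) μ) (n : ℕ) (b : ℝ) :
    iidLaw μ {ω | b ≤ obsSum L n ω} ≤ ENNReal.ofReal (Real.exp (-s * b) * mgf L μ s ^ n) := by
  have hmeas (k : ℕ) : Measurable fun ω : ℕ → 𝓧 => L (ω k) := hL.comp (measurable_pi_apply k)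
  have hindep : iIndepFun (fun (k : ℕ) (ω : ℕ → 𝓧) => L (ω k)) (iidLaw μ) :=
    iIndepFun_infinitePi fun _ => hL
  have hsum : obsSum L n = ∑ k ∈ Finset.range n, fun ω : ℕ → 𝓧 => L (ω k) := by
    ext ω
    simp [obsSum]
  have hdist (k : ℕ) := identDistrib_eval_iidLaw (μ := μ) hL k
  have hchernoff := measure_ge_le_exp_mul_mgf (μ := iidLaw μ) (X := obsSum L n) b hs ?_
  · rw [hsum, hindep.mgf_sum hmeas, Finset.prod_congr rfl fun k _ =>
      congrFun (mgf_congr_identDistrib (hdist k)) s, Finset.prod_const, Finset.card_range,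
      ← hsum] at hchernoff
    exact (ENNReal.le_ofReal_iff_toReal_le (measure_ne_top _ _)
      (mul_nonneg (Real.exp_nonneg _) (pow_nonneg mgf_nonneg _))).2 hchernoff
  · rw [hsum]
    exact hindep.integrable_exp_mul_sum hmeas fun k _ =>
      ((hdist k).comp (measurable_const_mul s).exp).integrable_iff.2 hint

lemma exists_iidLaw_le_obsSum_le_exp (hL : Measurable L) (hint : Integrable L μ)
    (hexp : Integrable (fun x => Real.exp (L x)) μ) {c : ℝ} (hc : μ[L] < c) :
    ∃ s > 0, ∃ r > 0, ∀ (n : ℕ) (b : ℝ),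
      iidLaw μ {ω | n * c - b ≤ obsSum L n ω} ≤ ENNReal.ofReal (Real.exp (s * b - r * n)) := by
  obtain ⟨c', hc', hc'c⟩ := exists_between hc
  obtain ⟨s, hs, hlt⟩ := exists_mgf_lt_exp_mul hint hexp hc'
  refine ⟨s, hs.1, s * (c - c'), mul_pos hs.1 (by linarith), fun n b => ?_⟩
  refine (iidLaw_le_obsSum_le_exp_mul_mgf_pow hL hs.1.le (integrable_exp_mul_of_nonneg_of_le
    (u := 1) (by simpa using hexp) hs.1.le hs.2.le) n _).trans (ENNReal.ofReal_le_ofReal ?_)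
  calc Real.exp (-s * (n * c - b)) * mgf L μ s ^ n
      ≤ Real.exp (-s * (n * c - b)) * Real.exp (s * c') ^ n := by gcongr; exact mgf_nonneg
    _ = Real.exp (s * b - s * (c - c') * n) := by
      rw [← Real.exp_nat_mul, ← Real.exp_add]
      ring_nf

lemma ae_tendsto_obsSum_div (hL : Measurable L) (hint : Integrable L μ) :
    ∀ᵐ ω ∂iidLaw μ, Tendsto (fun n : ℕ => obsSum L n ω / n) atTop (𝓝 μ[L]) := by
  have hdist (k : ℕ) := identDistrib_eval_iidLaw (μ := μ) hL k
  have hslln := strong_law_ae_real (μ := iidLaw μ) (fun k ω => L (ω k))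
    ((hdist 0).integrable_iff.2 hint)
    (fun _ _ hkl => (iIndepFun_infinitePi fun _ => hL).indepFun hkl)
    fun k => (hdist k).trans (hdist 0).symm
  rwa [(hdist 0).integral_eq] at hslln

lemma eventually_forall_le_mul {u : ℕ → ℝ} {a c : ℝ} (hc : 0 < c) (hac : a < c)
    (hu : Tendsto (fun n : ℕ => u n / n) atTop (𝓝 a)) :
    ∀ᶠ m : ℕ in atTop, ∀ n ≤ m, u n ≤ m * c := by
  obtain ⟨N, hN⟩ := eventually_atTop.1 (hu.eventually (gt_mem_nhds hac))
  obtain ⟨C, hC⟩ := ((Finset.range (N + 1)).image u).bddAbove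
  have hlarge : ∀ᶠ m : ℕ in atTop, C ≤ m * c :=
    (tendsto_natCast_atTop_atTop.atTop_mul_const hc).eventually_ge_atTop C
  filter_upwards [hlarge] with m hm n hn
  rcases le_or_gt n N with h | h
  · exact (hC (Finset.mem_coe.2 (Finset.mem_image_of_mem u (by simpa [Nat.lt_succ_iff])))).trans hm
  · have hn' : (0 : ℝ) < n := by exact_mod_cast h.pos
    calc u n ≤ n * c := ((div_lt_iff₀' hn').1 (hN n h.le)).le
      _ ≤ m * c := by gcongr

lemma tendsto_iidLaw_exists_lt_obsSum (hL : Measurable L) (hint : Integrable L μ) {c : ℝ}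
    (hc : 0 < c) (hLc : μ[L] < c) :
    Tendsto (fun m : ℕ => iidLaw μ {ω | ∃ n ≤ m, m * c < obsSum L n ω}) atTop (𝓝 0) := by
  have hmeas (m : ℕ) : MeasurableSet {ω | ∃ n ≤ m, m * c < obsSum L n ω} := by
    have hunion : {ω | ∃ n ≤ m, m * c < obsSum L n ω} = ⋃ n ≤ m, {ω | m * c < obsSum L n ω} := by
      ext ω
      simp
    rw [hunion]
    exact .biUnion (to_countable _) fun n _ => measurableSet_lt measurable_const (by fun_prop)
  have hlim := tendsto_measure_of_ae_tendsto_indicator (μ := iidLaw μ) atTop MeasurableSet.empty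
    hmeas MeasurableSet.univ (by simp) (by simp) ?_
  · simpa using hlim
  · filter_upwards [ae_tendsto_obsSum_div hL hint] with ω hω
    filter_upwards [eventually_forall_le_mul hc hLc hω] with m hm
    simpa using hm

end IidObservations

section ExpectedTime

lemma lintegral_coe_enat_eq_tsum {Ω : Type*} [MeasurableSpace Ω] (μ : Measure Ω) {T : Ω → ℕ∞}
    (hT : Measurable T) : ∫⁻ ω, (T ω : ℝ≥0∞) ∂μ = ∑' n : ℕ, μ {ω | n < T ω} := by
  have hmeas (n : ℕ) : MeasurableSet {ω | n < T ω} := hT (.of_discrete (s := Ioi (n : ℕ∞)))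
  have hcount (t : ℕ∞) : (t : ℝ≥0∞) = ∑' n : ℕ, if n < t then 1 else 0 := by
    induction t with
    | top => simp
    | coe k =>
      rw [tsum_eq_sum (s := Finset.range k) (by simp)]
      simp [Finset.filter_true_of_mem]
  calc ∫⁻ ω, (T ω : ℝ≥0∞) ∂μ = ∫⁻ ω, ∑' n : ℕ, {ω | n < T ω}.indicator 1 ω ∂μ := by
        simp only [hcount, indicator_apply, mem_ofPred, Pi.one_apply]
    _ = ∑' n : ℕ, μ {ω | n < T ω} := by
        rw [lintegral_tsum fun n => (measurable_one.indicator (hmeas n)).aemeasurable]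
        exact tsum_congr fun n => lintegral_indicator_one (hmeas n)

lemma tsum_le_of_exponential_tail {p : ℕ → ℝ≥0∞} (hp : ∀ n, p n ≤ 1) {B r : ℝ}
    (hB : 0 ≤ B) (hr : 0 < r) (h : ∀ n : ℕ, p n ≤ ENNReal.ofReal (Real.exp (B - r * n))) :
    ∑' n, p n ≤ ENNReal.ofReal (B / r + 1 + (1 - Real.exp (-r))⁻¹) := by
  have hq : Real.exp (-r) < 1 := by simpa using hr
  have hq0 := Real.exp_nonneg (-r)
  obtain ⟨N, hNle, hNlt⟩ : ∃ N : ℕ, B / r ≤ N ∧ (N : ℝ) < B / r + 1 :=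
    ⟨_, Nat.le_ceil _, Nat.ceil_lt_add_one (by positivity)⟩
  have hhead : ∑ n ∈ Finset.range N, p n ≤ ENNReal.ofReal (B / r + 1) :=
    calc ∑ n ∈ Finset.range N, p n ≤ ∑ n ∈ Finset.range N, 1 := Finset.sum_le_sum fun n _ => hp n
      _ = ENNReal.ofReal N := by simp
      _ ≤ _ := ENNReal.ofReal_le_ofReal hNlt.le
  have htail : ∑' n, p (n + N) ≤ ENNReal.ofReal (1 - Real.exp (-r))⁻¹ :=
    calc ∑' n, p (n + N) ≤ ∑' n : ℕ, ENNReal.ofReal (Real.exp (-r) ^ n) := by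
          refine ENNReal.tsum_le_tsum fun n => (h _).trans (ENNReal.ofReal_le_ofReal ?_)
          rw [← Real.exp_nat_mul]
          refine Real.exp_le_exp.2 ?_
          rw [div_le_iff₀ hr] at hNle
          push_cast
          nlinarith
      _ = ENNReal.ofReal (1 - Real.exp (-r))⁻¹ := by
          rw [← ENNReal.ofReal_tsum_of_nonneg (fun n => pow_nonneg hq0 n)
            (summable_geometric_of_lt_one hq0 hq), tsum_geometric_of_lt_one hq0 hq]
  have hpos : 0 ≤ (1 - Real.exp (-r))⁻¹ := inv_nonneg.2 (by linarith)
  have hpos' : 0 ≤ B / r + 1 := by positivity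
  calc ∑' n, p n = ∑ n ∈ Finset.range N, p n + ∑' n, p (n + N) :=
        (Summable.sum_add_tsum_nat_add' (f := p) (k := N) ENNReal.summable).symm
    _ ≤ ENNReal.ofReal (B / r + 1) + ENNReal.ofReal (1 - Real.exp (-r))⁻¹ :=
        add_le_add hhead htail
    _ = _ := (ENNReal.ofReal_add hpos' hpos).symm

lemma exists_forall_lintegral_le_of_neg_le_obsSum {𝓧 : Type*} [MeasurableSpace 𝓧]
    {μ : Measure 𝓧} [IsProbabilityMeasure μ] {L : 𝓧 → ℝ} (hL : Measurable L)
    (hint : Integrable L μ) (hexp : Integrable (fun x => Real.exp (L x)) μ) (hneg : μ[L] < 0) :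
    ∃ C : ℝ, ∀ B ≥ 0, ∀ T : (ℕ → 𝓧) → ℕ∞, Measurable T →
      (∀ (n : ℕ) ω, n < T ω → -B ≤ obsSum L n ω) →
      ∫⁻ ω, (T ω : ℝ≥0∞) ∂iidLaw μ ≤ ENNReal.ofReal (C * (B + 1)) := by
  obtain ⟨s, hs, r, hr, htail⟩ := exists_iidLaw_le_obsSum_le_exp hL hint hexp hneg
  refine ⟨s / r + 1 + (1 - Real.exp (-r))⁻¹, fun B hB T hT hbound => ?_⟩
  rw [lintegral_coe_enat_eq_tsum _ hT]
  refine (tsum_le_of_exponential_tail (fun n => prob_le_one) (mul_nonneg hs.le hB) hr fun n =>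
    (measure_mono fun ω hω => ?_).trans (htail n B)).trans (ENNReal.ofReal_le_ofReal ?_)
  · simpa using hbound n ω hω
  · have hexp_lt : 0 < 1 - Real.exp (-r) := by simpa using hr
    calc s * B / r + 1 + (1 - Real.exp (-r))⁻¹
        = s / r * B + (1 + (1 - Real.exp (-r))⁻¹) := by ring
      _ ≤ s / r * B + (1 + (1 - Real.exp (-r))⁻¹) + (s / r + (1 + (1 - Real.exp (-r))⁻¹) * B) :=
        le_add_of_nonneg_right (by positivity)
      _ = (s / r + 1 + (1 - Real.exp (-r))⁻¹) * (B + 1) := by ring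

end ExpectedTime

namespace SequentialTest

/-- The first time `n ≥ 1` at which the sum of `L` over the observations leaves `(-b, a)`. -/
noncomputable def exitTime {𝓧 : Type*} (L : 𝓧 → ℝ) (a b : ℝ) : (ℕ → 𝓧) → ℕ∞ :=
  hittingAfter (obsSum L) (Ioo (-b) a)ᶜ 1

lemma obsSum_mem_Icc_of_lt_exitTime {𝓧 : Type*} {L : 𝓧 → ℝ} {a b : ℝ} (ha : 0 ≤ a) (hb : 0 ≤ b)
    {n : ℕ} {ω : ℕ → 𝓧} (h : n < exitTime L a b ω) : obsSum L n ω ∈ Icc (-b) a := by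
  rcases Nat.eq_zero_or_pos n with rfl | hn
  · simp [ha, hb]
  · exact Ioo_subset_Icc_self (not_not.1 (notMem_of_lt_hittingAfter h hn))

variable {𝓧 : Type*} [MeasurableSpace 𝓧]

lemma measurable_T (τ : SequentialTest 𝓧) : Measurable τ.T :=
  ENat.measurable_iff.2 fun n => obsSigma_le n _ (τ.measurableSet_T n)

open Classical in
/-- The test that stops at time `T` and then decides for hypothesis `1` if the rejection event `R n`
of the attained sample size `n` occurs; if `T = ⊤` the decision is `0`. -/
noncomputable def ofRejection (T : (ℕ → 𝓧) → ℕ∞) (R : ℕ → Set (ℕ → 𝓧)) (one_le : ∀ ω, 1 ≤ T ω)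
    (hT : ∀ n : ℕ, MeasurableSet[obsSigma 𝓧 n] {ω | T ω = n})
    (hR : ∀ n, MeasurableSet[obsSigma 𝓧 n] (R n)) : SequentialTest 𝓧 where
  T := T
  D ω := if ∃ n : ℕ, T ω = n ∧ ω ∈ R n then 1 else 0
  one_le_T := one_le
  measurableSet_T := hT
  measurable_D := by
    refine Measurable.ite ?_ measurable_const measurable_const
    have hunion : {ω | ∃ n : ℕ, T ω = n ∧ ω ∈ R n} = ⋃ n : ℕ, {ω | T ω = n} ∩ R n := by
      ext ω
      simp
    rw [hunion]
    exact .iUnion fun n => (obsSigma_le n _ (hT n)).inter (obsSigma_le n _ (hR n))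
  measurableSet_D n i := by
    have hrej (ω) (hω : T ω = n) : (∃ n : ℕ, T ω = n ∧ ω ∈ R n) ↔ ω ∈ R n := by simp [hω]
    fin_cases i
    · convert! (hT n).inter (hR n).compl using 1
      ext ω
      exact and_congr_right fun hω => by simp [if_congr (hrej ω hω) rfl rfl]
    · convert! (hT n).inter (hR n) using 1
      ext ω
      exact and_congr_right fun hω => by simp [if_congr (hrej ω hω) rfl rfl]

lemma ofRejection_D_eq_one_iff {T : (ℕ → 𝓧) → ℕ∞} {R : ℕ → Set (ℕ → 𝓧)} {one_le hT hR}
    {ω : ℕ → 𝓧} : (ofRejection T R one_le hT hR).D ω = 1 ↔ ∃ n : ℕ, T ω = n ∧ ω ∈ R n := by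
  simp [ofRejection]

variable {μ ν : Measure 𝓧} [IsProbabilityMeasure μ] {L : 𝓧 → ℝ}

lemma iidLaw_decision_le_exp_mul [IsProbabilityMeasure ν] (h : IsLogLikelihoodRatio μ ν L)
    (τ : SequentialTest 𝓧) (i : Fin 2) (b : ℝ) :
    iidLaw ν {ω | ∃ n : ℕ, (τ.T ω = n ∧ τ.D ω = i) ∧ obsSum L n ω ≤ b} ≤
      ENNReal.ofReal (Real.exp b) * iidLaw μ {ω | τ.D ω = i} := by
  set A : ℕ → Set (ℕ → 𝓧) := fun n => {ω | (τ.T ω = n ∧ τ.D ω = i) ∧ obsSum L n ω ≤ b}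
  have hA (n : ℕ) : MeasurableSet[obsSigma 𝓧 n] (A n) :=
    MeasurableSet.inter (τ.measurableSet_D n i)
      (measurable_obsSum_obsSigma h.measurable n measurableSet_Iic)
  have hdisj : Pairwise (Function.onFun Disjoint A) := fun n m hnm =>
    Set.disjoint_left.2 fun ω hn hm => hnm (ENat.natCast_inj.1 (hn.1.1.symm.trans hm.1.1))
  rw [ofPred_exists]
  refine (h.iidLaw_iUnion_le_exp_mul hA hdisj fun n ω hω => hω.2).trans ?_
  gcongr
  exact iUnion_subset fun n ω hω => hω.1.2

lemma compl_le_T_subset (τ : SequentialTest 𝓧) {i j : Fin 2} (hij : i ≠ j) (L : 𝓧 → ℝ) (m : ℕ)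
    (b : ℝ) :
    {ω | (m : ℝ≥0∞) ≤ τ.T ω}ᶜ ⊆ {ω | τ.D ω = j} ∪
      {ω | ∃ n : ℕ, (τ.T ω = n ∧ τ.D ω = i) ∧ obsSum L n ω ≤ b} ∪
      {ω | ∃ n ≤ m, b < obsSum L n ω} := by
  intro ω hω
  have hTm : τ.T ω < m := by
    simpa only [mem_compl_iff, mem_ofPred, not_le, ← ENat.toENNReal_coe, ENat.toENNReal_lt] using hω
  obtain ⟨n, hn⟩ := ENat.ne_top_iff_exists.1 hTm.ne_top
  have hnm : n < m := by exact_mod_cast hn ▸ hTm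
  by_cases hD : τ.D ω = j
  · exact Or.inl (Or.inl hD)
  · rcases le_or_gt (obsSum L n ω) b with hb | hb
    · exact Or.inl (Or.inr ⟨n, ⟨hn.symm, by omega⟩, hb⟩)
    · exact Or.inr ⟨n, hnm.le, hb⟩

/-- To end before time `m` a test has to err under `ν`, or to decide correctly while the likelihood
ratio `dν/dμ` is at most `exp b` (which also has to happen under `μ`, where it is an error), or
the likelihood ratio has to exceed `exp b` early. -/
lemma mul_one_sub_le_lintegral_T [IsProbabilityMeasure ν] (h : IsLogLikelihoodRatio μ ν L)
    (τ : SequentialTest 𝓧) {i j : Fin 2} (hij : i ≠ j) (m : ℕ) (b : ℝ) :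
    (m : ℝ≥0∞) * (1 - (iidLaw ν {ω | τ.D ω = j} +
      ENNReal.ofReal (Real.exp b) * iidLaw μ {ω | τ.D ω = i} +
      iidLaw ν {ω | ∃ n ≤ m, b < obsSum L n ω})) ≤ ∫⁻ ω, (τ.T ω : ℝ≥0∞) ∂iidLaw ν := by
  have hT : Measurable fun ω => (τ.T ω : ℝ≥0∞) := (measurable_of_countable _).comp τ.measurable_T
  refine le_trans ?_ (mul_meas_ge_le_lintegral hT (m : ℝ≥0∞))
  gcongr
  rw [tsub_le_iff_left, ← prob_add_prob_compl (μ := iidLaw ν)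
    (measurableSet_le measurable_const hT), add_comm]
  gcongr
  refine (measure_mono (τ.compl_le_T_subset hij L m b)).trans ((measure_union_le _ _).trans ?_)
  gcongr
  exact (measure_union_le _ _).trans (by gcongr; exact τ.iidLaw_decision_le_exp_mul h i b)

lemma measurableSet_exitTime_eq (hL : Measurable L) (a b : ℝ) (n : ℕ) :
    MeasurableSet[obsSigma 𝓧 n] {ω | exitTime L a b ω = n} := by
  let obsFiltration : Filtration ℕ MeasurableSpace.pi :=
    ⟨obsSigma 𝓧, obsSigma_mono, obsSigma_le⟩
  have hadapted : Adapted obsFiltration (obsSum L) := measurable_obsSum_obsSigma hL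
  exact (hadapted.isStoppingTime_hittingAfter measurableSet_Ioo.compl).measurableSet_eq n

/-- The sequential probability ratio test with boundaries `-b` and `a`. -/
noncomputable def sprt (hL : Measurable L) (a b : ℝ) : SequentialTest 𝓧 :=
  ofRejection (exitTime L a b) (fun n => {ω | a ≤ obsSum L n ω}) (fun _ => le_hittingAfter _)
    (measurableSet_exitTime_eq hL a b)
    fun n => measurable_obsSum_obsSigma hL n measurableSet_Ici

lemma sprt_decision_one_le (h : IsLogLikelihoodRatio μ ν L) [IsProbabilityMeasure ν] (a b : ℝ) :
    iidLaw μ {ω | (sprt h.measurable a b).D ω = 1} ≤ ENNReal.ofReal (Real.exp (-a)) := by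
  refine (measure_mono fun ω hω => ?_).trans
    (((sprt h.measurable a b).iidLaw_decision_le_exp_mul h.symm 1 (-a)).trans
      (mul_le_of_le_one_right' prob_le_one))
  obtain ⟨n, hn, ha⟩ := ofRejection_D_eq_one_iff.1 hω
  exact ⟨n, ⟨hn, hω⟩, by simpa using ha⟩

lemma sprt_decision_zero_le (h : IsLogLikelihoodRatio μ ν L) [IsProbabilityMeasure ν] {a b : ℝ}
    (hfin : ∀ᵐ ω ∂iidLaw ν, exitTime L a b ω ≠ ⊤) :
    iidLaw ν {ω | (sprt h.measurable a b).D ω = 0} ≤ ENNReal.ofReal (Real.exp (-b)) := by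
  refine (measure_mono_ae ?_).trans
    (((sprt h.measurable a b).iidLaw_decision_le_exp_mul h 0 (-b)).trans
      (mul_le_of_le_one_right' prob_le_one))
  filter_upwards [hfin] with ω hω (hD : (sprt h.measurable a b).D ω = 0)
  obtain ⟨n, hn⟩ := ENat.ne_top_iff_exists.1 hω
  have hexit : obsSum L n ω ∉ Ioo (-b) a := by
    have hmem := hittingAfter_mem_set_of_ne_top hω
    rw [← exitTime, ← hn] at hmem
    exact hmem
  have hacc : obsSum L n ω < a := by
    by_contra! ha
    have hD' : (sprt h.measurable a b).D ω = 1 := ofRejection_D_eq_one_iff.2 ⟨n, hn.symm, ha⟩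
    exact zero_ne_one (hD.symm.trans hD')
  exact ⟨n, ⟨hn.symm, hD⟩, by simpa [hacc] using hexit⟩

end SequentialTest

section Asymptotics

lemma tendsto_div_ofReal_of_eventually_le {ι : Type*} {l : Filter ι} {u : ι → ℝ≥0∞} {t : ι → ℝ}
    {κ : ℝ} (hκ : 0 < κ) (ht : Tendsto t l atTop)
    (hlower : ∀ y ∈ Ioo 0 κ, ∀ᶠ k in l, ENNReal.ofReal (y * t k) ≤ u k)
    (hupper : ∀ y > κ, ∀ᶠ k in l, u k ≤ ENNReal.ofReal (y * t k)) :
    Tendsto (fun k => u k / ENNReal.ofReal (t k)) l (𝓝 (ENNReal.ofReal κ)) := by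
  have hscale : ∀ᶠ k in l, ∀ y : ℝ, ENNReal.ofReal (y * t k) / ENNReal.ofReal (t k) =
      ENNReal.ofReal y := by
    filter_upwards [ht.eventually_gt_atTop 0] with k hk y
    rw [← ENNReal.ofReal_div_of_pos hk, mul_div_cancel_right₀ _ hk.ne']
  refine tendsto_order.2 ⟨fun a ha => ?_, fun a ha => ?_⟩
  · lift a to ℝ≥0 using ha.ne_top
    have haκ : (a : ℝ) < κ := by simpa [ENNReal.lt_ofReal_iff_toReal_lt] using ha
    obtain ⟨y, hay, hyκ⟩ := exists_between haκ
    filter_upwards [hscale, hlower y ⟨a.2.trans_lt hay, hyκ⟩] with k hk hu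
    refine lt_of_lt_of_le ?_ (ENNReal.div_le_div_right hu _)
    rw [hk]
    simpa [ENNReal.lt_ofReal_iff_toReal_lt] using hay
  · obtain ⟨y, -, hκy, hya⟩ := ENNReal.lt_iff_exists_real_btwn.1 ha
    filter_upwards [hscale, hupper y ((ENNReal.ofReal_lt_ofReal_iff_of_nonneg hκ.le).1 hκy)]
      with k hk hu
    exact (ENNReal.div_le_div_right hu _).trans_lt ((hk y).trans_lt hya)

lemma exp_neg_abs_log {x : ℝ} (hx : x ∈ Ioo (0 : ℝ) 1) : Real.exp (-|Real.log x|) = x := by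
  rw [abs_of_neg (Real.log_neg hx.1 hx.2), neg_neg, Real.exp_log hx.1]

lemma tendsto_abs_log_atTop {ι : Type*} {l : Filter ι} {e : ι → ℝ} (he : ∀ k, e k ∈ Ioo (0 : ℝ) 1)
    (hlim : Tendsto e l (𝓝 0)) : Tendsto (fun k => |Real.log (e k)|) l atTop :=
  tendsto_abs_atBot_atTop.comp (Real.tendsto_log_nhdsGT_zero.comp
    (tendsto_nhdsWithin_iff.2 ⟨hlim, Eventually.of_forall fun k => (he k).1⟩))

lemma exists_eventually_mul_le_floor_mul {y z c : ℝ} (hy : 0 < y) (hyz : y < z) (hc : 0 < c)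
    (hcz : c < z⁻¹) :
    ∃ δ > 0, ∀ᶠ t in atTop, Real.exp (⌊z * t⌋₊ * c + -t) ≤ δ ∧ y * t ≤ ⌊z * t⌋₊ * (1 - 3 * δ) := by
  have hz : 0 < z := hy.trans hyz
  have hczt : z * c - 1 < 0 := by
    rw [lt_inv_comm₀ hc hz, inv_eq_one_div, lt_div_iff₀ hc] at hcz
    linarith
  obtain ⟨δ, hδ, hyδ⟩ : ∃ δ > 0, y < z * (1 - 3 * δ) := by
    refine ⟨(1 - y / z) / 6, by linarith [(div_lt_one hz).2 hyz], ?_⟩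
    field_simp
    linarith
  have hexp := (Real.tendsto_exp_atBot.comp
    (tendsto_id.const_mul_atTop_of_neg hczt)).eventually (gt_mem_nhds hδ)
  have hfloor := ((tendsto_nat_floor_mul_div_atTop hz.le).mul_const (1 - 3 * δ)).eventually
    (lt_mem_nhds hyδ)
  refine ⟨δ, hδ, ?_⟩
  filter_upwards [hexp, hfloor, eventually_gt_atTop 0] with t hexp hfloor ht
  refine ⟨(Real.exp_le_exp.2 ?_).trans hexp.le, ?_⟩
  · have := mul_le_mul_of_nonneg_right (Nat.floor_le (mul_pos hz ht).le) hc.le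
    change _ ≤ (z * c - 1) * t
    linarith
  · rw [div_mul_eq_mul_div, lt_div_iff₀ ht] at hfloor
    exact hfloor.le

variable {𝓧 : Type*} [MeasurableSpace 𝓧] {μ ν : Measure 𝓧} [IsProbabilityMeasure μ]
  [IsProbabilityMeasure ν] {L : 𝓧 → ℝ}

namespace IsLogLikelihoodRatio

/-- Below `t / ν[L]` observations the likelihood ratio `dν/dμ` does not reach `exp t`, which the
second error bound requires of a test that decides correctly under `ν`. -/
lemma exists_eventually_forall_le_lintegral_T (h : IsLogLikelihoodRatio μ ν L)
    (hint : Integrable L ν) (hpos : 0 < ν[L]) {i j : Fin 2} (hij : i ≠ j) {y : ℝ} (hy : 0 < y)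
    (hyL : y < ν[L]⁻¹) :
    ∃ δ > 0, ∀ᶠ t in atTop, ∀ τ : SequentialTest 𝓧,
      iidLaw ν {ω | τ.D ω = j} ≤ ENNReal.ofReal δ →
      iidLaw μ {ω | τ.D ω = i} ≤ ENNReal.ofReal (Real.exp (-t)) →
      ENNReal.ofReal (y * t) ≤ ∫⁻ ω, (τ.T ω : ℝ≥0∞) ∂iidLaw ν := by
  obtain ⟨z, hyz, hzL⟩ := exists_between hyL
  obtain ⟨c, hLc, hcz⟩ := exists_between ((lt_inv_comm₀ (hy.trans hyz) hpos).1 hzL)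
  have hc : 0 < c := hpos.trans hLc
  obtain ⟨δ, hδ, hlarge⟩ := exists_eventually_mul_le_floor_mul hy hyz hc hcz
  have hexceed := ((tendsto_iidLaw_exists_lt_obsSum h.measurable hint hc hLc).comp
    (tendsto_nat_floor_atTop.comp (tendsto_id.const_mul_atTop (hy.trans hyz)))).eventually
    (gt_mem_nhds (ENNReal.ofReal_pos.2 hδ))
  refine ⟨δ, hδ, ?_⟩
  filter_upwards [hlarge, hexceed] with t ⟨hexp, hfloor⟩ hexceed τ hτν hτμ
  have hchange : ENNReal.ofReal (Real.exp (⌊z * t⌋₊ * c)) * iidLaw μ {ω | τ.D ω = i} ≤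
      ENNReal.ofReal δ := by
    refine (mul_le_mul_right hτμ _).trans ?_
    rw [← ENNReal.ofReal_mul (Real.exp_nonneg _), ← Real.exp_add]
    exact ENNReal.ofReal_le_ofReal hexp
  calc ENNReal.ofReal (y * t) ≤ ENNReal.ofReal (⌊z * t⌋₊ * (1 - 3 * δ)) :=
        ENNReal.ofReal_le_ofReal hfloor
    _ = ⌊z * t⌋₊ * (1 - (ENNReal.ofReal δ + ENNReal.ofReal δ + ENNReal.ofReal δ)) := by
        rw [← ENNReal.ofReal_add hδ.le hδ.le, ← ENNReal.ofReal_add (by positivity) hδ.le,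
          ← ENNReal.ofReal_one, ← ENNReal.ofReal_sub _ (by positivity),
          ENNReal.ofReal_mul (Nat.cast_nonneg _), ENNReal.ofReal_natCast]
        ring_nf
    _ ≤ _ := by gcongr; exact hexceed.le
    _ ≤ _ := τ.mul_one_sub_le_lintegral_T h hij _ _

lemma exists_forall_iidLaw_le_exp (h : IsLogLikelihoodRatio μ ν L) (hint : Integrable L ν) {y : ℝ}
    (hy : 0 < y) (hyL : y⁻¹ < ν[L]) :
    ∃ r > 0, ∀ (n : ℕ) (v t : ℝ), v ≤ r * t → y * t ≤ n →
      iidLaw ν {ω | obsSum L n ω ≤ n * y⁻¹} ≤ ENNReal.ofReal (Real.exp (-v)) ∧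
      iidLaw μ {ω | n * y⁻¹ ≤ obsSum L n ω} ≤ ENNReal.ofReal (Real.exp (-t)) := by
  obtain ⟨_, -, r, hr, hbound⟩ := exists_iidLaw_le_obsSum_le_exp h.symm.measurable hint.neg
    h.symm.integrable_exp (c := -y⁻¹) (by simpa [integral_neg] using hyL)
  refine ⟨r * y, by positivity, fun n v t hvt hyt => ⟨?_, ?_⟩⟩
  · refine (measure_mono fun ω hω => ?_).trans ((hbound n 0).trans (ENNReal.ofReal_le_ofReal ?_))
    · simpa using hω
    · have := mul_le_mul_of_nonneg_left hyt hr.le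
      gcongr
      linarith
  · refine (measure_mono fun ω hω => ?_).trans (h.symm.iidLaw_obsSum_le n (-t))
    have hn : t ≤ n * y⁻¹ := by rwa [← div_eq_mul_inv, le_div_iff₀' hy]
    simpa using hn.trans hω

lemma exists_forall_lintegral_exitTime_le (h : IsLogLikelihoodRatio μ ν L) (hμ : Integrable L μ)
    (hν : Integrable L ν) (hneg : μ[L] < 0) (hpos : 0 < ν[L]) :
    ∃ C : ℝ, ∀ a ≥ 0, ∀ b ≥ 0,
      ∫⁻ ω, (SequentialTest.exitTime L a b ω : ℝ≥0∞) ∂iidLaw μ ≤ ENNReal.ofReal (C * (b + 1)) ∧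
      ∫⁻ ω, (SequentialTest.exitTime L a b ω : ℝ≥0∞) ∂iidLaw ν ≤ ENNReal.ofReal (C * (a + 1)) := by
  obtain ⟨C, hC⟩ :=
    exists_forall_lintegral_le_of_neg_le_obsSum h.measurable hμ h.integrable_exp hneg
  obtain ⟨C', hC'⟩ := exists_forall_lintegral_le_of_neg_le_obsSum h.symm.measurable hν.neg
    h.symm.integrable_exp (by simpa [integral_neg] using hpos)
  refine ⟨max C C', fun a ha b hb => ?_⟩
  have hT := (SequentialTest.sprt h.measurable a b).measurable_T
  constructor
  · refine (hC b hb _ hT fun n ω hn =>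
      (SequentialTest.obsSum_mem_Icc_of_lt_exitTime ha hb hn).1).trans ?_
    gcongr
    exact le_max_left _ _
  · refine (hC' a ha _ hT fun n ω hn => ?_).trans ?_
    · rw [obsSum_neg]
      exact neg_le_neg (SequentialTest.obsSum_mem_Icc_of_lt_exitTime ha hb hn).2
    · gcongr
      exact le_max_right _ _

end IsLogLikelihoodRatio

lemma tendsto_div_of_tendsto_div_ofReal {ι : Type*} {l : Filter ι} {u v : ι → ℝ≥0∞} {t : ι → ℝ}
    {a b : ℝ≥0∞} (ht : Tendsto t l atTop) (ha : a ≠ ∞) (hb : b ≠ 0)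
    (hu : Tendsto (fun k => u k / ENNReal.ofReal (t k)) l (𝓝 a))
    (hv : Tendsto (fun k => v k / ENNReal.ofReal (t k)) l (𝓝 b)) :
    Tendsto (fun k => u k / v k) l (𝓝 (a / b)) := by
  refine (ENNReal.Tendsto.div hu (Or.inr hb) hv (Or.inr ha)).congr' ?_
  filter_upwards [ht.eventually_gt_atTop 0] with k hk
  simp only [div_eq_mul_inv]
  exact ENNReal.mul_div_mul_right _ _ (by simp) (by simpa using hk)

end Asymptotics

namespace BinaryTestingProblem

variable {𝓧 : Type*} [MeasurableSpace 𝓧] (M : BinaryTestingProblem 𝓧)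

/-- The log-likelihood ratio of hypothesis `j` against hypothesis `i` based on one observation. -/
noncomputable def logRatio (i j : Fin 2) (x : 𝓧) : ℝ :=
  Real.log (M.f j x / M.f i x)

lemma logRatio_swap (i j : Fin 2) : M.logRatio j i = -M.logRatio i j := by
  ext x
  rw [logRatio, ← inv_div, Real.log_inv]
  rfl

lemma measurable_logRatio (i j : Fin 2) : Measurable (M.logRatio i j) :=
  Real.measurable_log.comp (((M.measurable_f j).coe_nnreal_real).div
    ((M.measurable_f i).coe_nnreal_real))

variable {M}

lemma ae_imp_ne_zero {i j : Fin 2} (hac : M.law i ≪ M.law j) :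
    ∀ᵐ x ∂M.ν, M.f i x ≠ 0 → M.f j x ≠ 0 := by
  have hpos (k : Fin 2) {p : 𝓧 → Prop} : (∀ᵐ x ∂M.law k, p x) ↔ ∀ᵐ x ∂M.ν, M.f k x ≠ 0 → p x := by
    rw [law, ae_withDensity_iff (M.measurable_f k).coe_nnreal_ennreal]
    simp
  exact (hpos i).1 (hac.ae_le ((hpos j).2 (ae_of_all _ fun _ h => h)))

lemma mul_exp_logRatio {i j : Fin 2} {x : 𝓧} (hi : M.f i x ≠ 0) (hj : M.f j x ≠ 0) (s : ℝ) :
    (M.f i x : ℝ≥0∞) * ENNReal.ofReal (Real.exp (s * M.logRatio i j x)) =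
      (M.f j x : ℝ≥0∞) ^ s * (M.f i x : ℝ≥0∞) ^ (1 - s) := by
  have hi' : (0 : ℝ) < M.f i x := by positivity
  have hj' : (0 : ℝ) < M.f j x := by positivity
  rw [mul_comm s, Real.exp_mul, logRatio, Real.exp_log (div_pos hj' hi'),
    ← ENNReal.ofReal_coe_nnreal, ← ENNReal.ofReal_coe_nnreal, ENNReal.ofReal_rpow_of_pos hj',
    ENNReal.ofReal_rpow_of_pos hi', ← ENNReal.ofReal_mul hi'.le,
    ← ENNReal.ofReal_mul (by positivity), Real.div_rpow hj'.le hi'.le, Real.rpow_sub hi',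
    Real.rpow_one]
  congr 1
  field_simp

/-- At a common zero of the densities the right-hand side vanishes because one of the exponents
`s`, `1 - s` is positive and `0 ^ 0 = 1`. -/
lemma ae_mul_exp_logRatio (hac : ∀ i j, M.law i ≪ M.law j) (i j : Fin 2) (s : ℝ) :
    ∀ᵐ x ∂M.ν, (M.f i x : ℝ≥0∞) * ENNReal.ofReal (Real.exp (s * M.logRatio i j x)) =
      (M.f j x : ℝ≥0∞) ^ s * (M.f i x : ℝ≥0∞) ^ (1 - s) := by
  filter_upwards [ae_imp_ne_zero (hac i j), ae_imp_ne_zero (hac j i)] with x hij hji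
  by_cases hi : M.f i x = 0
  · have hj : M.f j x = 0 := not_imp_not.1 hji hi
    rcases lt_trichotomy s 0 with hs | rfl | hs
    · simp [hi, hj, ENNReal.zero_rpow_of_pos (show 0 < 1 - s by linarith)]
    · simp [hi]
    · simp [hi, hj, ENNReal.zero_rpow_of_pos hs]
  · exact mul_exp_logRatio hi (hij hi) s

lemma lintegral_exp_mul_logRatio (hac : ∀ i j, M.law i ≪ M.law j) (i j : Fin 2) (s : ℝ) :
    ∫⁻ x, ENNReal.ofReal (Real.exp (s * M.logRatio i j x)) ∂M.law i =
      ∫⁻ x, (M.f j x : ℝ≥0∞) ^ s * (M.f i x : ℝ≥0∞) ^ (1 - s) ∂M.ν := by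
  have hmeas := M.measurable_logRatio i j
  rw [law, lintegral_withDensity_eq_lintegral_mul _ (M.measurable_f i).coe_nnreal_ennreal
    (by fun_prop)]
  exact lintegral_congr_ae (ae_mul_exp_logRatio hac i j s)

section FiniteDivergence

variable (hfin : ∀ i j, klDiv (M.law i) (M.law j) ≠ ∞)

include hfin

lemma absolutelyContinuous_law (i j : Fin 2) : M.law i ≪ M.law j :=
  (klDiv_ne_top_iff.1 (hfin i j)).1

lemma isLogLikelihoodRatio (i j : Fin 2) :
    IsLogLikelihoodRatio (M.law i) (M.law j) (M.logRatio i j) where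
  measurable := M.measurable_logRatio i j
  withDensity_exp := by
    have hmeas := M.measurable_logRatio i j
    rw [law, ← withDensity_mul _ (M.measurable_f i).coe_nnreal_ennreal (by fun_prop), law]
    refine withDensity_congr_ae ?_
    filter_upwards [ae_mul_exp_logRatio (absolutelyContinuous_law hfin) i j 1] with x hx
    simpa using hx

lemma integrable_logRatio (i j : Fin 2) : Integrable (M.logRatio i j) (M.law i) :=
  (isLogLikelihoodRatio hfin i j).integrable (hfin i j)

lemma integral_logRatio (i j : Fin 2) :
    (M.law i)[M.logRatio i j] = -(klDiv (M.law i) (M.law j)).toReal :=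
  (isLogLikelihoodRatio hfin i j).integral_eq_neg_toReal_klDiv

lemma integrable_logRatio_right (i j : Fin 2) : Integrable (M.logRatio i j) (M.law j) := by
  rw [logRatio_swap]
  exact (integrable_logRatio hfin j i).neg

lemma integral_logRatio_right (i j : Fin 2) :
    (M.law j)[M.logRatio i j] = (klDiv (M.law j) (M.law i)).toReal := by
  rw [logRatio_swap, integral_neg', integral_logRatio hfin, neg_neg]

lemma ψ₀_eq_chernoffRate {c : ℝ} (hc : c ≤ M.I₁.toReal) :
    M.ψ₀ c = chernoffRate (M.logRatio 0 1) (M.law 0) c := by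
  rw [← (isLogLikelihoodRatio hfin 0 1).legendreNonneg_eq_chernoffRate
    (integrable_logRatio hfin 0 1) (integrable_logRatio_right hfin 0 1)
    (by rwa [integral_logRatio_right hfin])]
  simp only [ψ₀, legendreNonneg, lintegral_exp_mul_logRatio (absolutelyContinuous_law hfin)]

/-- The substitution `θ ↦ -θ` exchanges the roles of the two hypotheses. -/
lemma ψ₁_eq_chernoffRate_sub {c : ℝ} (hc : -M.I₀.toReal ≤ c) :
    M.ψ₁ c = chernoffRate (M.logRatio 0 1) (M.law 0) c - c := by
  have hlegendre : M.ψ₁ c = legendreNonneg (M.logRatio 1 0) (M.law 1) (-c) := by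
    simp only [ψ₁, legendreNonneg, lintegral_exp_mul_logRatio (absolutelyContinuous_law hfin)]
    refine (Equiv.neg ℝ).iSup_congr fun θ => ?_
    simp
  rw [hlegendre, (isLogLikelihoodRatio hfin 1 0).legendreNonneg_eq_chernoffRate
    (integrable_logRatio hfin 1 0) (integrable_logRatio_right hfin 1 0)
    (by rw [integral_logRatio_right hfin]; exact neg_le.1 hc), logRatio_swap,
    (isLogLikelihoodRatio hfin 0 1).chernoffRate_neg (integrable_logRatio hfin 0 1), EReal.coe_sub]

lemma g_eq {c : ℝ} (hc : c ∈ Ioo (-M.I₀.toReal) M.I₁.toReal) :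
    M.g c = chernoffRate (M.logRatio 0 1) (M.law 0) c /
      (chernoffRate (M.logRatio 0 1) (M.law 0) c - c) := by
  rw [g, ψ₀_eq_chernoffRate hfin hc.2.le, ψ₁_eq_chernoffRate_sub hfin hc.1.le, ← EReal.coe_sub,
    EReal.toReal_coe, EReal.toReal_coe]

variable (hpos : ∀ i j, i ≠ j → 0 < klDiv (M.law i) (M.law j))

include hpos

lemma integral_logRatio_neg {i j : Fin 2} (hij : i ≠ j) : (M.law i)[M.logRatio i j] < 0 := by
  rw [integral_logRatio hfin, neg_lt_zero]
  exact ENNReal.toReal_pos (hpos i j hij).ne' (hfin i j)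

lemma integral_logRatio_right_pos {i j : Fin 2} (hij : i ≠ j) :
    0 < (M.law j)[M.logRatio i j] := by
  rw [integral_logRatio_right hfin]
  exact ENNReal.toReal_pos (hpos j i hij.symm).ne' (hfin j i)

lemma exists_mem_Ioo_g_eq {u : ℝ} (hu : 0 < u) :
    ∃ c ∈ Ioo (-M.I₀.toReal) M.I₁.toReal, M.g c = u := by
  obtain ⟨c, hc, hcu⟩ := (isLogLikelihoodRatio hfin 0 1).exists_chernoffRate_ratio_eq
    (integrable_logRatio hfin 0 1) (integrable_logRatio_right hfin 0 1)
    (integral_logRatio_neg hfin hpos zero_ne_one)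
    (integral_logRatio_right_pos hfin hpos zero_ne_one) hu
  rw [integral_logRatio hfin, integral_logRatio_right hfin] at hc
  exact ⟨c, hc, (g_eq hfin hc).trans hcu⟩

lemma gInv_mem_Ioo {u : ℝ} (hu : 0 < u) : M.gInv u ∈ Ioo (-M.I₀.toReal) M.I₁.toReal :=
  Function.invFunOn_mem (exists_mem_Ioo_g_eq hfin hpos hu)

lemma g_gInv {u : ℝ} (hu : 0 < u) : M.g (M.gInv u) = u :=
  Function.invFunOn_eq (exists_mem_Ioo_g_eq hfin hpos hu)

lemma tendsto_ψ₁_gInv {ι : Type*} {l : Filter ι} {u : ι → ℝ} (hu : ∀ k, 0 < u k)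
    (hlim : Tendsto u l (𝓝 0)) :
    Tendsto (fun k => (M.ψ₁ (M.gInv (u k))).toReal) l (𝓝 M.I₀.toReal) := by
  have hmem (k : ι) := gInv_mem_Ioo hfin hpos (hu k)
  have hrate := (isLogLikelihoodRatio hfin 0 1).tendsto_chernoffRate_sub
    (integrable_logRatio hfin 0 1) (integrable_logRatio_right hfin 0 1)
    (c := fun k => M.gInv (u k)) (l := l)
    (by rwa [integral_logRatio hfin, integral_logRatio_right hfin])
    (hlim.congr fun k => by rw [← g_eq hfin (hmem k), g_gInv hfin hpos (hu k)])
  rw [integral_logRatio hfin, neg_neg] at hrate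
  exact hrate.congr fun k => by
    rw [ψ₁_eq_chernoffRate_sub hfin (hmem k).1.le, ← EReal.coe_sub, EReal.toReal_coe]

lemma tendsto_ψ₀_gInv {ι : Type*} {l : Filter ι} {u : ι → ℝ} (hu : ∀ k, 0 < u k)
    (hlim : Tendsto u l atTop) :
    Tendsto (fun k => (M.ψ₀ (M.gInv (u k))).toReal) l (𝓝 M.I₁.toReal) := by
  have hmem (k : ι) := gInv_mem_Ioo hfin hpos (hu k)
  have hrate := (isLogLikelihoodRatio hfin 0 1).tendsto_chernoffRate
    (integrable_logRatio hfin 0 1) (integrable_logRatio_right hfin 0 1)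
    (c := fun k => M.gInv (u k)) (l := l)
    (by rwa [integral_logRatio hfin, integral_logRatio_right hfin])
    (hlim.congr fun k => by rw [← g_eq hfin (hmem k), g_gInv hfin hpos (hu k)])
  rw [integral_logRatio_right hfin] at hrate
  exact hrate.congr fun k => by rw [ψ₀_eq_chernoffRate hfin (hmem k).2.le, EReal.toReal_coe]

end FiniteDivergence

end BinaryTestingProblem

namespace BinaryTestingProblem

variable {𝓧 : Type*} [MeasurableSpace 𝓧] {M : BinaryTestingProblem 𝓧}

/-- The sample sizes of the fixed-sample-size likelihood ratio tests with error probabilities at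
most `α` and `β`; `M.nStar α β` is the smallest one. -/
def fixedSampleSizes (M : BinaryTestingProblem 𝓧) (α β : ℝ) : Set ℕ :=
  {n | 1 ≤ n ∧ ∃ c : ℝ, M.P 0 {ω | c < M.avgLlr n ω} ≤ ENNReal.ofReal α ∧
    M.P 1 {ω | M.avgLlr n ω ≤ c} ≤ ENNReal.ofReal β}

lemma mem_testClass_iff {e : Fin 2 → ℝ} {τ : SequentialTest 𝓧} :
    τ ∈ M.testClass (e 0) (e 1) ↔ (∀ i, ∀ᵐ ω ∂M.P i, τ.T ω ≠ ⊤) ∧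
      ∀ i j, i ≠ j → M.P i {ω | τ.D ω = j} ≤ ENNReal.ofReal (e i) := by
  simp [testClass, Fin.forall_fin_two]

lemma optESS_le_of_mem_fixedSampleSizes {α β : ℝ} {n : ℕ} (hn : n ∈ M.fixedSampleSizes α β)
    (i : Fin 2) : M.optESS i α β ≤ n := by
  obtain ⟨hn, c, hα, hβ⟩ := hn
  have hmeas (m : ℕ) : MeasurableSet[obsSigma 𝓧 m] {ω | c < M.avgLlr m ω} :=
    (measurable_obsSum_obsSigma (M.measurable_logRatio 0 1) m).div_const _ measurableSet_Ioi
  let τ := SequentialTest.ofRejection (fun _ => n) (fun m => {ω | c < M.avgLlr m ω})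
    (fun _ => by exact_mod_cast hn) (fun _ => MeasurableSet.const _) hmeas
  have hD (ω) : τ.D ω = 1 ↔ c < M.avgLlr n ω := by
    simp [τ, SequentialTest.ofRejection_D_eq_one_iff]
  have hD' (ω) : τ.D ω = 0 ↔ M.avgLlr n ω ≤ c := by
    rw [← not_lt, ← hD]
    omega
  have hτ : τ ∈ M.testClass α β := by
    refine ⟨fun _ => ae_of_all _ fun _ => ENat.natCast_ne_top n, ?_, ?_⟩
    · simpa only [hD] using hα
    · simpa only [hD'] using hβ
  exact (iInf₂_le τ hτ).trans_eq (by simp [τ, SequentialTest.ofRejection, P])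

lemma mem_fixedSampleSizes_of_obsSum_le {i j : Fin 2} (hij : i ≠ j) {e : Fin 2 → ℝ} {n : ℕ}
    (hn : 1 ≤ n) {c : ℝ}
    (hi : M.P i {ω | obsSum (M.logRatio j i) n ω ≤ n * c} ≤ ENNReal.ofReal (e i))
    (hj : M.P j {ω | n * c ≤ obsSum (M.logRatio j i) n ω} ≤ ENNReal.ofReal (e j)) :
    n ∈ M.fixedSampleSizes (e 0) (e 1) := by
  have hn' : (0 : ℝ) < n := by exact_mod_cast hn
  have havg (ω) : M.avgLlr n ω = obsSum (M.logRatio 0 1) n ω / n := rfl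
  rcases Fin.exists_fin_two.1 ⟨i, rfl⟩ with rfl | rfl
  · obtain rfl : j = 1 := by omega
    rw [logRatio_swap, obsSum_neg] at hi hj
    refine ⟨hn, -c, (measure_mono fun ω hω => ?_).trans hi, (measure_mono fun ω hω => ?_).trans hj⟩
    · rw [mem_ofPred, havg, lt_div_iff₀' hn'] at hω
      change -obsSum _ n ω ≤ _
      linarith
    · rw [mem_ofPred, havg, div_le_iff₀' hn'] at hω
      change _ ≤ -obsSum _ n ω
      linarith
  · obtain rfl : j = 0 := by omega
    refine ⟨hn, c, (measure_mono fun ω hω => ?_).trans hj, (measure_mono fun ω hω => ?_).trans hi⟩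
    · rw [mem_ofPred, havg, lt_div_iff₀' hn'] at hω
      exact hω.le
    · rwa [mem_ofPred, havg, div_le_iff₀' hn'] at hω

section SmallErrors

variable (hfin : ∀ i j, klDiv (M.law i) (M.law j) ≠ ∞)
  (hpos : ∀ i j, i ≠ j → 0 < klDiv (M.law i) (M.law j))

include hfin hpos

lemma exists_forall_optESS_le :
    ∃ C : ℝ, ∀ e : Fin 2 → ℝ, (∀ i, e i ∈ Ioo (0 : ℝ) 1) → ∀ i j, i ≠ j →
      M.optESS i (e 0) (e 1) ≤ ENNReal.ofReal (C * (|Real.log (e j)| + 1)) := by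
  have h := isLogLikelihoodRatio hfin 0 1
  obtain ⟨C, hC⟩ := h.exists_forall_lintegral_exitTime_le (integrable_logRatio hfin 0 1)
    (integrable_logRatio_right hfin 0 1) (integral_logRatio_neg hfin hpos zero_ne_one)
    (integral_logRatio_right_pos hfin hpos zero_ne_one)
  refine ⟨C, fun e he => ?_⟩
  let τ := SequentialTest.sprt h.measurable |Real.log (e 0)| |Real.log (e 1)|
  have hess (i j) (hij : i ≠ j) :
      ∫⁻ ω, (τ.T ω : ℝ≥0∞) ∂M.P i ≤ ENNReal.ofReal (C * (|Real.log (e j)| + 1)) := by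
    have hC := hC _ (abs_nonneg (Real.log (e 0))) _ (abs_nonneg (Real.log (e 1)))
    rcases Fin.exists_fin_two.1 ⟨i, rfl⟩ with rfl | rfl
    · obtain rfl : j = 1 := by omega
      exact hC.1
    · obtain rfl : j = 0 := by omega
      exact hC.2
  have hT_ne_top (i) : ∀ᵐ ω ∂M.P i, τ.T ω ≠ ⊤ := by
    obtain ⟨j, hij⟩ := exists_ne i
    filter_upwards [ae_lt_top ((measurable_of_countable _).comp τ.measurable_T)
      ((hess i j hij.symm).trans_lt ENNReal.ofReal_lt_top).ne] with ω hω
    simpa using hω.ne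
  have hτ : τ ∈ M.testClass (e 0) (e 1) := by
    refine ⟨hT_ne_top, (SequentialTest.sprt_decision_one_le h _ _).trans_eq ?_,
      (SequentialTest.sprt_decision_zero_le h (hT_ne_top 1)).trans_eq ?_⟩
    · rw [exp_neg_abs_log (he 0)]
    · rw [exp_neg_abs_log (he 1)]
  exact fun i j hij => (iInf₂_le τ hτ).trans (hess i j hij)

variable {ι : Type*} {l : Filter ι} {e : ι → Fin 2 → ℝ} (he : ∀ k i, e k i ∈ Ioo (0 : ℝ) 1)
  (hlim : ∀ i, Tendsto (fun k => e k i) l (𝓝 0)) {i j : Fin 2} (hij : i ≠ j)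

include he hlim hij

lemma eventually_le_optESS {y : ℝ} (hy : y ∈ Ioo 0 (klDiv (M.law i) (M.law j)).toReal⁻¹) :
    ∀ᶠ k in l, ENNReal.ofReal (y * |Real.log (e k j)|) ≤ M.optESS i (e k 0) (e k 1) := by
  obtain ⟨δ, hδ, hlower⟩ := (isLogLikelihoodRatio hfin j i).exists_eventually_forall_le_lintegral_T
    (integrable_logRatio_right hfin j i) (integral_logRatio_right_pos hfin hpos hij.symm) hij hy.1
    (by rw [integral_logRatio_right hfin]; exact hy.2)
  filter_upwards [(tendsto_abs_log_atTop (fun k => he k j) (hlim j)).eventually hlower,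
    (hlim i).eventually (gt_mem_nhds hδ)] with k hk hδk
  refine le_iInf₂ fun τ hτ => ?_
  obtain ⟨-, herr⟩ := mem_testClass_iff.1 hτ
  refine hk τ ((herr i j hij).trans (ENNReal.ofReal_le_ofReal hδk.le))
    ((herr j i hij.symm).trans_eq ?_)
  rw [exp_neg_abs_log (he k j)]

variable (hratio : Tendsto (fun k => |Real.log (e k i)| / |Real.log (e k j)|) l (𝓝 0))

include hratio

lemma eventually_exists_mem_fixedSampleSizes_le {y : ℝ}
    (hy : (klDiv (M.law i) (M.law j)).toReal⁻¹ < y) :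
    ∀ᶠ k in l, ∃ n ∈ M.fixedSampleSizes (e k 0) (e k 1),
      (n : ℝ≥0∞) ≤ ENNReal.ofReal (y * |Real.log (e k j)|) := by
  obtain ⟨z, hKz, hzy⟩ := exists_between hy
  have hK : 0 < (klDiv (M.law i) (M.law j)).toReal :=
    ENNReal.toReal_pos (hpos i j hij).ne' (hfin i j)
  have hz : 0 < z := (inv_pos.2 hK).trans hKz
  have h := isLogLikelihoodRatio hfin j i
  obtain ⟨r, hr, hbound⟩ := h.exists_forall_iidLaw_le_exp (integrable_logRatio_right hfin j i) hz
    (by rw [integral_logRatio_right hfin]; exact inv_lt_of_inv_lt₀ hK hKz)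
  have hlog := tendsto_abs_log_atTop (fun k => he k j) (hlim j)
  have hceil := ((tendsto_nat_ceil_mul_div_atTop hz.le).comp hlog).eventually (gt_mem_nhds hzy)
  filter_upwards [hceil, hratio.eventually (gt_mem_nhds hr), hlog.eventually_gt_atTop 0]
    with k hceil hratio hlog
  refine ⟨⌈z * |Real.log (e k j)|⌉₊, ?_, ?_⟩
  · obtain ⟨hi, hj⟩ := hbound _ _ _ ((div_lt_iff₀ hlog).1 hratio).le (Nat.le_ceil _)
    rw [exp_neg_abs_log (he k _)] at hi hj
    exact mem_fixedSampleSizes_of_obsSum_le hij (Nat.ceil_pos.2 (mul_pos hz hlog)) hi hj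
  · rw [← ENNReal.ofReal_natCast]
    exact ENNReal.ofReal_le_ofReal ((div_lt_iff₀ hlog).1 hceil).le

lemma eventually_nStar_le {y : ℝ} (hy : (klDiv (M.law i) (M.law j)).toReal⁻¹ < y) :
    ∀ᶠ k in l, (M.nStar (e k 0) (e k 1) : ℝ≥0∞) ≤ ENNReal.ofReal (y * |Real.log (e k j)|) := by
  filter_upwards [eventually_exists_mem_fixedSampleSizes_le hfin hpos he hlim hij hratio hy]
    with k ⟨n, hmem, hn⟩
  exact (Nat.cast_le.2 (Nat.sInf_le hmem)).trans hn

lemma eventually_optESS_le_nStar (i' : Fin 2) :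
    ∀ᶠ k in l, M.optESS i' (e k 0) (e k 1) ≤ M.nStar (e k 0) (e k 1) := by
  filter_upwards [eventually_exists_mem_fixedSampleSizes_le hfin hpos he hlim hij hratio
    (lt_add_one _)] with k ⟨n, hmem, _⟩
  exact optESS_le_of_mem_fixedSampleSizes (Nat.sInf_mem ⟨n, hmem⟩) i'

lemma tendsto_optESS_div_abs_log :
    Tendsto (fun k => M.optESS i (e k 0) (e k 1) / ENNReal.ofReal |Real.log (e k j)|) l
      (𝓝 (ENNReal.ofReal (klDiv (M.law i) (M.law j)).toReal⁻¹)) := by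
  refine tendsto_div_ofReal_of_eventually_le
    (inv_pos.2 (ENNReal.toReal_pos (hpos i j hij).ne' (hfin i j)))
    (tendsto_abs_log_atTop (fun k => he k j) (hlim j))
    (fun y hy => eventually_le_optESS hfin hpos he hlim hij hy) fun y hy => ?_
  filter_upwards [eventually_optESS_le_nStar hfin hpos he hlim hij hratio i,
    eventually_nStar_le hfin hpos he hlim hij hratio hy] with k hess hn
  exact hess.trans hn

lemma tendsto_nStar_div_abs_log :
    Tendsto (fun k => (M.nStar (e k 0) (e k 1) : ℝ≥0∞) / ENNReal.ofReal |Real.log (e k j)|) l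
      (𝓝 (ENNReal.ofReal (klDiv (M.law i) (M.law j)).toReal⁻¹)) := by
  refine tendsto_div_ofReal_of_eventually_le
    (inv_pos.2 (ENNReal.toReal_pos (hpos i j hij).ne' (hfin i j)))
    (tendsto_abs_log_atTop (fun k => he k j) (hlim j)) (fun y hy => ?_)
    fun y hy => eventually_nStar_le hfin hpos he hlim hij hratio hy
  filter_upwards [eventually_optESS_le_nStar hfin hpos he hlim hij hratio i,
    eventually_le_optESS hfin hpos he hlim hij hy] with k hess hle
  exact hle.trans hess

lemma tendsto_optESS_div_abs_log_zero :
    Tendsto (fun k => M.optESS j (e k 0) (e k 1) / ENNReal.ofReal |Real.log (e k j)|) l (𝓝 0) := by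
  obtain ⟨C, hC⟩ := exists_forall_optESS_le hfin hpos
  have hlog := tendsto_abs_log_atTop (fun k => he k j) (hlim j)
  have hbound : Tendsto (fun k => ENNReal.ofReal
      (C * (|Real.log (e k i)| / |Real.log (e k j)| + |Real.log (e k j)|⁻¹))) l (𝓝 0) := by
    simpa using ENNReal.tendsto_ofReal ((hratio.add hlog.inv_tendsto_atTop).const_mul C)
  refine tendsto_of_tendsto_of_tendsto_of_le_of_le' tendsto_const_nhds hbound
    (Eventually.of_forall fun _ => zero_le) ?_
  filter_upwards [hlog.eventually_gt_atTop 0] with k hk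
  refine (ENNReal.div_le_div_right (hC (e k) (he k) j i hij.symm) _).trans_eq ?_
  rw [← ENNReal.ofReal_div_of_pos hk]
  ring_nf

lemma tendsto_optESS_div_nStar :
    Tendsto (fun k => M.optESS j (e k 0) (e k 1) / (M.nStar (e k 0) (e k 1) : ℝ≥0∞)) l
      (𝓝 0) := by
  have hK := inv_pos.2 (ENNReal.toReal_pos (hpos i j hij).ne' (hfin i j))
  simpa using tendsto_div_of_tendsto_div_ofReal
    (tendsto_abs_log_atTop (fun k => he k j) (hlim j)) ENNReal.zero_ne_top
    (ENNReal.ofReal_pos.2 hK).ne' (tendsto_optESS_div_abs_log_zero hfin hpos he hlim hij hratio)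
    (tendsto_nStar_div_abs_log hfin hpos he hlim hij hratio)

lemma tendsto_nStar_div_optESS :
    Tendsto (fun k => (M.nStar (e k 0) (e k 1) : ℝ≥0∞) / M.optESS i (e k 0) (e k 1)) l
      (𝓝 1) := by
  have hK := (ENNReal.ofReal_pos.2
    (inv_pos.2 (ENNReal.toReal_pos (hpos i j hij).ne' (hfin i j)))).ne'
  rw [← ENNReal.div_self hK ENNReal.ofReal_ne_top]
  exact tendsto_div_of_tendsto_div_ofReal
    (tendsto_abs_log_atTop (fun k => he k j) (hlim j)) ENNReal.ofReal_ne_top hK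
    (tendsto_nStar_div_abs_log hfin hpos he hlim hij hratio)
    (tendsto_optESS_div_abs_log hfin hpos he hlim hij hratio)

end SmallErrors

end BinaryTestingProblem

open BinaryTestingProblem in
theorem mainTheorem8_general {𝓧 : Type*} [MeasurableSpace 𝓧] (M : BinaryTestingProblem 𝓧)
    (hI₀_pos : 0 < M.I₀) (hI₀_fin : M.I₀ < ∞) (hI₁_pos : 0 < M.I₁) (hI₁_fin : M.I₁ < ∞)
    {ι : Type*} {l : Filter ι} (α β : ι → ℝ)
    (hα : ∀ k, α k ∈ Ioo (0 : ℝ) 1) (hβ : ∀ k, β k ∈ Ioo (0 : ℝ) 1)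
    (hα_lim : Tendsto α l (𝓝 0)) (hβ_lim : Tendsto β l (𝓝 0)) :
    (Tendsto (fun k => |Real.log (α k)| / |Real.log (β k)|) l (𝓝 0) →
      Tendsto (fun k => M.h₁ (α k) (β k)) l (𝓝 M.I₀.toReal) ∧
      Tendsto (fun k => M.optESS 1 (α k) (β k) / (M.nStar (α k) (β k) : ℝ≥0∞)) l (𝓝 0) ∧
      Tendsto (fun k => (M.nStar (α k) (β k) : ℝ≥0∞) / M.optESS 0 (α k) (β k)) l (𝓝 1)) ∧
    (Tendsto (fun k => |Real.log (α k)| / |Real.log (β k)|) l atTop →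
      Tendsto (fun k => M.h₀ (α k) (β k)) l (𝓝 M.I₁.toReal) ∧
      Tendsto (fun k => M.optESS 0 (α k) (β k) / (M.nStar (α k) (β k) : ℝ≥0∞)) l (𝓝 0) ∧
      Tendsto (fun k => (M.nStar (α k) (β k) : ℝ≥0∞) / M.optESS 1 (α k) (β k)) l (𝓝 1)) := by
  have hfin : ∀ i j, klDiv (M.law i) (M.law j) ≠ ∞ := by
    simp only [Fin.forall_fin_two, klDiv_self]
    exact ⟨⟨ENNReal.zero_ne_top, hI₀_fin.ne⟩, hI₁_fin.ne, ENNReal.zero_ne_top⟩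
  have hpos : ∀ i j, i ≠ j → 0 < klDiv (M.law i) (M.law j) := by
    simpa [Fin.forall_fin_two, I₀, I₁] using And.intro hI₀_pos hI₁_pos
  have hu (k) : 0 < |Real.log (α k)| / |Real.log (β k)| :=
    div_pos (abs_pos.2 (Real.log_neg (hα k).1 (hα k).2).ne)
      (abs_pos.2 (Real.log_neg (hβ k).1 (hβ k).2).ne)
  let e (k : ι) : Fin 2 → ℝ := ![α k, β k]
  have he (k i) : e k i ∈ Ioo (0 : ℝ) 1 := by
    fin_cases i
    exacts [hα k, hβ k]
  have hlim (i) : Tendsto (fun k => e k i) l (𝓝 0) := by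
    fin_cases i
    exacts [hα_lim, hβ_lim]
  have hswap (hratio : Tendsto (fun k => |Real.log (α k)| / |Real.log (β k)|) l atTop) :
      Tendsto (fun k => |Real.log (β k)| / |Real.log (α k)|) l (𝓝 0) := by
    simpa only [Pi.inv_def, inv_div] using hratio.inv_tendsto_atTop
  refine ⟨fun hratio => ⟨tendsto_ψ₁_gInv hfin hpos hu hratio, ?_, ?_⟩,
    fun hratio => ⟨tendsto_ψ₀_gInv hfin hpos hu hratio, ?_, ?_⟩⟩
  · exact tendsto_optESS_div_nStar (e := e) hfin hpos he hlim zero_ne_one hratio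
  · exact tendsto_nStar_div_optESS (e := e) hfin hpos he hlim zero_ne_one hratio
  · exact tendsto_optESS_div_nStar (e := e) hfin hpos he hlim one_ne_zero (hswap hratio)
  · exact tendsto_nStar_div_optESS (e := e) hfin hpos he hlim one_ne_zero (hswap hratio)

theorem mainTheorem8 {𝓧 : Type*} [MeasurableSpace 𝓧] (M : BinaryTestingProblem 𝓧)
    (hI₀_pos : 0 < M.I₀) (hI₀_fin : M.I₀ < ∞) (hI₁_pos : 0 < M.I₁) (hI₁_fin : M.I₁ < ∞)
    (α β : ℕ → ℝ) (hα : ∀ k, α k ∈ Ioo (0 : ℝ) 1) (hβ : ∀ k, β k ∈ Ioo (0 : ℝ) 1)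
    (hα_lim : Tendsto α atTop (𝓝 0)) (hβ_lim : Tendsto β atTop (𝓝 0)) :
    (Tendsto (fun k => |Real.log (α k)| / |Real.log (β k)|) atTop (𝓝 0) →
      Tendsto (fun k => M.h₁ (α k) (β k)) atTop (𝓝 M.I₀.toReal) ∧
      Tendsto (fun k => M.optESS 1 (α k) (β k) / (M.nStar (α k) (β k) : ℝ≥0∞)) atTop (𝓝 0) ∧
      Tendsto (fun k => (M.nStar (α k) (β k) : ℝ≥0∞) / M.optESS 0 (α k) (β k)) atTop (𝓝 1)) ∧
    (Tendsto (fun k => |Real.log (α k)| / |Real.log (β k)|) atTop atTop →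
      Tendsto (fun k => M.h₀ (α k) (β k)) atTop (𝓝 M.I₁.toReal) ∧
      Tendsto (fun k => M.optESS 0 (α k) (β k) / (M.nStar (α k) (β k) : ℝ≥0∞)) atTop (𝓝 0) ∧
      Tendsto (fun k => (M.nStar (α k) (β k) : ℝ≥0∞) / M.optESS 1 (α k) (β k)) atTop (𝓝 1)) :=
  mainTheorem8_general M hI₀_pos hI₀_fin hI₁_pos hI₁_fin α β hα hβ hα_lim hβ_lim
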